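/- Let $\omega>0$, let $k\ge 0$ be an integer and let $\lambda>k$. For $\vec x,\vec y,\vec x',\vec y'\in\mathbb R^3$ put $$G^\lambda_\omega(\vec x,\vec y;\vec x',\vec y')=\frac{\omega^{2}}{2^{3/2}\pi^{3}}\int_0^1 d\nu\,\frac{\nu^{\lambda/\omega-1}}{(1-\nu^2)^{3/2}\left(\ln\frac1\nu\right)^{3/2}}\exp\left\{-\frac{\omega}{2}\,\frac{1-\nu}{1+\nu}\left(y^2+y'^2\right)-\frac{\omega}{2\ln\frac1\nu}(\vec x-\vec x')^2-\frac{\omega\nu}{1-\nu^2}(\vec y-\vec y')^2\right\},$$ the Green function (resolvent kernel at $-\lambda$) of $-\frac12\Delta_{\vec x}-\frac12\Delta_{\vec y}+\frac{\omega^2y^2}{2}-\frac{3\omega}{2}$. Then this kernel defines a bounded integral operator $G^\lambda_\omega$ on $L^2(\mathbb R^6)$, the formula $$\mathcal G^\lambda_\omega f(\vec x,\vec y)=\int_{\mathbb R^3}G^\lambda_\omega(\vec x,\vec y;\vec x',\vec x')\,f(\vec x')\,d\vec x'$$ defines a bounded operator $\mathcal G^\lambda_\omega:L^2(\mathbb R^3)\to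 L^2(\mathbb R^6)$, and for every real $p>\dfrac{3}{k+1/2}$ the operator $$T^k_\omega=(\mathcal G^\lambda_\omega)^*\,(G^\lambda_\omega)^k\,\mathcal G^\lambda_\omega:L^2(\mathbb R^3)\to L^2(\mathbb R^3)$$ belongs to the Schatten class $\mathscr B_p(L^2(\mathbb R^3))$, that is, it is compact and its singular values $\mu_0\ge\mu_1\ge\dots\ge0$ (repeated according to multiplicity) satisfy $\sum_n\mu_n^p<\infty$. -/

import Mathlib

open MeasureTheory

noncomputable section

namespace ZeroRange

/-- The configuration space `ℝ³` of one particle, with its Euclidean norm. -/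
abbrev R3 : Type := EuclideanSpace ℝ (Fin 3)

/-- `L²(ℝ³)`. -/
abbrev L2R3 : Type := Lp ℂ 2 (volume : Measure R3)

/-- `L²(ℝ⁶)`, a point of `ℝ⁶` being a pair `(x, y)` of points of `ℝ³`. -/
abbrev L2R6 : Type := Lp ℂ 2 (volume : Measure (R3 × R3))

/-- The Green function `G_ω^λ(x, y; x', y')` in dimension three, that is, the integral kernel of
`(H₀ + λ)⁻¹` for `H₀ = -Δ_x / 2 - Δ_y / 2 + ω² |y|² / 2 - 3 ω / 2`. The first point is `(x, y)`,
the second one is `(x', y')`. The integral converges absolutely when the two points differ. -/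
def greenKernel (ω lam : ℝ) (X X' : R3 × R3) : ℝ :=
  ω ^ 2 / ((2 : ℝ) ^ (3 / 2 : ℝ) * Real.pi ^ 3) *
    ∫ ν in Set.Ioo (0 : ℝ) 1,
      ν ^ (lam / ω - 1) / ((1 - ν ^ 2) ^ (3 / 2 : ℝ) * Real.log (1 / ν) ^ (3 / 2 : ℝ)) *
        Real.exp
          (-(ω / 2 * ((1 - ν) / (1 + ν)) * (‖X.2‖ ^ 2 + ‖X'.2‖ ^ 2))
            - ω / (2 * Real.log (1 / ν)) * ‖X.1 - X'.1‖ ^ 2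
            - ω * ν / (1 - ν ^ 2) * ‖X.2 - X'.2‖ ^ 2)

/-- The kernel `G_ω^λ(x, y; x', x')` of the potential of a charge carried by the plane `x = y`. -/
def potentialKernel (ω lam : ℝ) (X : R3 × R3) (x' : R3) : ℝ :=
  greenKernel ω lam X (x', x')

/-- The bounded operator `T` is the integral operator with kernel `K`: for every `f` in `L²` one has
`(T f)(y) = ∫ K(y, x) f(x) dx` for almost every `y`, with an absolutely convergent integral. -/
def IsIntegralOperator {X Y : Type*} [MeasurableSpace X] [MeasurableSpace Y]
    {μ : Measure X} {ν : Measure Y} (T : Lp ℂ 2 μ →L[ℂ] Lp ℂ 2 ν) (K : Y → X → ℝ) : Prop :=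
  ∀ f : Lp ℂ 2 μ,
    (∀ᵐ y ∂ν, Integrable (fun x => (K y x : ℂ) * f x) μ) ∧
      ∀ᵐ y ∂ν, T f y = ∫ x, (K y x : ℂ) * f x ∂μ

/-- There is at most one integral operator with a given kernel. -/
theorem IsIntegralOperator.unique {X Y : Type*} [MeasurableSpace X] [MeasurableSpace Y]
    {μ : Measure X} {ν : Measure Y} {T S : Lp ℂ 2 μ →L[ℂ] Lp ℂ 2 ν} {K : Y → X → ℝ}
    (hT : IsIntegralOperator T K) (hS : IsIntegralOperator S K) : T = S := by
  ext1 f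
  apply Lp.ext
  filter_upwards [(hT f).2, (hS f).2] with y h1 h2
  rw [h1, h2]

section Schatten

variable {H H' : Type*} [NormedAddCommGroup H] [InnerProductSpace ℂ H] [CompleteSpace H]
  [NormedAddCommGroup H'] [InnerProductSpace ℂ H'] [CompleteSpace H']

/-- The eigenspace of `A* A` for the eigenvalue `t²`. For `t > 0` it is nonzero exactly when `t` is a
singular value of `A`, and its dimension is then the multiplicity of `t`. -/
def singularSpace (A : H →L[ℂ] H') (t : ℝ) : Submodule ℂ H :=
  Module.End.eigenspace ((A.adjoint ∘L A : H →L[ℂ] H) : H →ₗ[ℂ] H) ((t : ℂ) ^ 2)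

/-- The singular values `μ₀ ≥ μ₁ ≥ …` of a compact operator `A`, in decreasing order and repeated
according to multiplicity: `μₙ` is the least `s ≥ 0` such that at most `n` singular values,
counted with multiplicity, are greater than `s`. -/
def singularValue (A : H →L[ℂ] H') (n : ℕ) : ℝ :=
  sInf {s : ℝ | 0 ≤ s ∧ Module.rank ℂ ↥(⨆ t : Set.Ioi s, singularSpace A t) ≤ (n : Cardinal)}

/-- Membership in the Schatten class `𝓑_p(H, H')` for a finite exponent `p > 0`: the operator is
compact and its singular values are `p`-summable. -/
def IsSchatten (p : ℝ) (A : H →L[ℂ] H') : Prop :=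
  IsCompactOperator A ∧ Summable fun n : ℕ => singularValue A n ^ p

end Schatten

end ZeroRange

end

/-! The substitution `ν = exp (-ω t)` turns the Green function into the Laplace transform, at `lam`,
of the kernel of S_t = exp(-t H₀), which is a heat kernel in x times a Mehler kernel in y. So G = ∫
exp(-λt) S_t dt and P = ∫ exp(-λt) E_t dt, where E_t has the kernel of S_t with its second point on
the plane x = y, and S_s E_t = E_{s+t}.

Singular values are counted through the sesquilinear form of T = P* G^k P. If for every N it is
O(N^{-(k+1/2)}) on the orthogonal complement of a subspace V of dimension O(N³), then only O(N³)
singular values exceed that size, so μ_n = O(n^{-(k+1/2)/3}), which is p-summable for p > 3/(k+1/2)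
(`singularValue_le`, `isSchatten_of_form_le`). Since ⟨u, T f⟩ = ⟨P u, G^k P f⟩, it suffices that
‖G^m P f‖ = O(N^{-(m+1/4)}) ‖f‖ on Vᗮ for m = 0 and m = k. This follows from ‖E_t f‖ ≤ C (t^{-3/4}
exp(-cNt) + exp(-cN)) ‖f‖: the integral of t^{-3/4} exp(-cNt) gives N^{-1/4}, and each factor G
gains 1/N (`isSchatten_adjoint_comp_pow_comp`).

For the decay of E_t: the kernel of E_t* E_t is a Gaussian exp(-a|z|²) exp(-b|z-z'|²) exp(-a|z'|²).
A Mehler kernel of frequency 2ω has the same shape, with the same a and some b' > b. The factor with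
the smaller b arises from the other one by further smoothing, so E_t is dominated by the oscillator
semigroup of frequency 2ω, with a constant O(t^{-3/4}) for small t (`norm_sq_le_of_gaussKernel`,
`norm_traceOp_le`). For that semigroup V is the span of the eigenvectors at time 1/N with eigenvalue
above 1/e. The Hilbert–Schmidt norm bounds its dimension by O(N³), and the semigroup law carries the
decay to all times, so that one V serves every t (`exists_submodule_mehlerOp`,
`exists_submodule_traceOp`). -/

noncomputable section

namespace ZeroRange

open scoped InnerProductSpace

/-! ### Compactness and spectral cut-off from sums over orthonormal families -/

section Hilbert

variable {H H' : Type*} [NormedAddCommGroup H] [InnerProductSpace ℂ H]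
  [NormedAddCommGroup H'] [InnerProductSpace ℂ H']

theorem isCompactOperator_comp_starProjection (A : H →L[ℂ] H') (V : Submodule ℂ H)
    [FiniteDimensional ℂ V] : IsCompactOperator (A ∘L V.starProjection) := by
  have h1 : IsCompactOperator (id : V → V) := isCompactOperator_id_iff_finiteDimensional.2 ‹_›
  have h2 := (h1.clm_comp (A ∘L V.subtypeL)).comp_clm V.orthogonalProjectionOnto
  exact h2

theorem isCompactOperator_of_forall_norm_le [CompleteSpace H'] (A : H →L[ℂ] H')
    (h : ∀ ε > 0, ∃ B : H →L[ℂ] H', IsCompactOperator B ∧ ‖A - B‖ ≤ ε) :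
    IsCompactOperator A := by
  have hc : IsClosed {f : H →L[ℂ] H' | IsCompactOperator f} := isClosed_setOfPred_isCompactOperator
  have : A ∈ closure {f : H →L[ℂ] H' | IsCompactOperator f} := by
    rw [Metric.mem_closure_iff]
    intro ε hε
    obtain ⟨B, hB, hAB⟩ := h (ε / 2) (by positivity)
    exact ⟨B, hB, by rw [dist_eq_norm]; linarith⟩
  rwa [hc.closure_eq] at this

/-- An operator that is square summable on orthonormal families, with a uniform bound, is compact. -/
theorem isCompactOperator_of_sum_le [CompleteSpace H'] {A : H →L[ℂ] H'} {C : ℝ}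
    (hC : ∀ (ι : Type) [Fintype ι] (v : ι → H), Orthonormal ℂ v → ∑ i, ‖A (v i)‖ ^ 2 ≤ C) :
    IsCompactOperator A := by
  set X : Set ℝ := {s | ∃ (n : ℕ) (v : Fin n → H), Orthonormal ℂ v ∧ s = ∑ i, ‖A (v i)‖ ^ 2}
  have hX : BddAbove X := ⟨C, by rintro s ⟨n, v, hv, rfl⟩; exact hC _ v hv⟩
  have hX0 : X.Nonempty := ⟨0, 0, Fin.elim0, ⟨fun i => i.elim0, fun i => i.elim0⟩, by simp⟩
  refine isCompactOperator_of_forall_norm_le A fun ε hε => ?_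
  -- A family within `ε ^ 2` of the supremum: appending a unit vector orthogonal to it cannot exceed
  -- the supremum, so `A` is at most `ε` on that vector.
  obtain ⟨s, ⟨n, v, hv, rfl⟩, hs⟩ := exists_lt_of_lt_csSup hX0
    (show sSup X - ε ^ 2 < sSup X by linarith [pow_pos hε 2])
  obtain ⟨V, hV⟩ : ∃ V : Submodule ℂ H, V = Submodule.span ℂ (Set.range v) := ⟨_, rfl⟩
  have hfin : FiniteDimensional ℂ V := hV ▸ FiniteDimensional.span_of_finite ℂ (Set.finite_range v)
  refine ⟨A ∘L V.starProjection, isCompactOperator_comp_starProjection A V, ?_⟩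
  have key : ∀ f ∈ Vᗮ, ‖f‖ = 1 → ‖A f‖ ≤ ε := by
    intro f hf hf1
    have hvf : ∀ i, ⟪v i, f⟫_ℂ = 0 := fun i => hf _ (hV ▸ Submodule.subset_span ⟨i, rfl⟩)
    have hw : Orthonormal ℂ (Fin.cons f v : Fin (n + 1) → H) := by
      rw [orthonormal_iff_ite] at hv ⊢
      intro i j
      refine Fin.cases ?_ (fun i => ?_) i <;> refine Fin.cases ?_ (fun j => ?_) j
      · simp [hf1]
      · simp [← inner_conj_symm f, hvf, (Fin.succ_ne_zero j).symm]
      · simp [hvf]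
      · simp [hv]
    have h1 : ∑ i, ‖A ((Fin.cons f v : Fin (n + 1) → H) i)‖ ^ 2 ≤ sSup X :=
      le_csSup hX ⟨n + 1, _, hw, rfl⟩
    rw [Fin.sum_univ_succ] at h1
    simp only [Fin.cons_zero, Fin.cons_succ] at h1
    exact le_of_sq_le_sq (by linarith) hε.le
  have key2 : ∀ f ∈ Vᗮ, ‖A f‖ ≤ ε * ‖f‖ := by
    intro f hf
    rcases eq_or_ne f 0 with rfl | h0
    · simp
    have h1 := key (((‖f‖⁻¹ : ℝ) : ℂ) • f) (Vᗮ.smul_mem _ hf) (by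
      rw [norm_smul]; simp [norm_ne_zero_iff.2 h0])
    rw [map_smul, norm_smul] at h1
    simp only [Complex.ofReal_inv, norm_inv, Complex.norm_real, norm_norm] at h1
    rwa [inv_mul_le_iff₀ (norm_pos_iff.2 h0), mul_comm] at h1
  refine ContinuousLinearMap.opNorm_le_bound _ hε.le fun f => ?_
  have h2 : (A - A ∘L V.starProjection) f = A (f - V.starProjection f) := by simp
  rw [h2]
  refine (key2 _ (V.sub_starProjection_mem_orthogonal f)).trans ?_
  gcongr
  rw [← Submodule.starProjection_orthogonal_val]
  exact Submodule.norm_starProjection_apply_le _ f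

/-- A self-adjoint operator whose sums of squares over orthonormal families are at most `C` is
bounded by `θ`, with all its powers, off a subspace of dimension at most `C / θ²`. -/
theorem exists_submodule_pow_le [CompleteSpace H] {A : H →L[ℂ] H} (hA : IsSelfAdjoint A) {C : ℝ}
    (hC : ∀ (ι : Type) [Fintype ι] (v : ι → H), Orthonormal ℂ v → ∑ i, ‖A (v i)‖ ^ 2 ≤ C)
    {θ : ℝ} (hθ : 0 < θ) :
    ∃ V : Submodule ℂ H, FiniteDimensional ℂ V ∧ Module.finrank ℂ V * θ ^ 2 ≤ C ∧
      ∀ j : ℕ, ∀ f ∈ Vᗮ, ‖(A ^ j) f‖ ≤ θ ^ j * ‖f‖ := by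
  have hcomp := isCompactOperator_of_sum_le hC
  have hsym : (A : H →ₗ[ℂ] H).IsSymmetric := hA.isSymmetric
  -- On the sum of these orthogonal eigenspaces `A` expands by at least `θ`, so each vector of an
  -- orthonormal family there contributes at least `θ ^ 2` to a sum bounded by `C`. This bounds the
  -- dimension.
  set W : {μ : ℂ // θ < ‖μ‖} → Submodule ℂ H := fun μ => Module.End.eigenspace (A : H →ₗ[ℂ] H) μ
  set V : Submodule ℂ H := ⨆ μ, W μ
  have hortho : OrthogonalFamily ℂ (fun μ => W μ) fun μ => (W μ).subtypeₗᵢ :=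
    hsym.orthogonalFamily_eigenspaces.comp Subtype.val_injective
  have hlow : ∀ f ∈ V, θ * ‖f‖ ≤ ‖A f‖ := by
    intro f hf
    rw [Submodule.mem_iSup_iff_exists_finsupp] at hf
    obtain ⟨g, hg, rfl⟩ := hf
    set w : ∀ μ, W μ := fun μ => ⟨g μ, hg μ⟩
    have h1 : ‖g.sum fun _ x => x‖ ^ 2 = ∑ μ ∈ g.support, ‖g μ‖ ^ 2 :=
      hortho.norm_sum w g.support
    have h2 : A (g.sum fun _ x => x) = ∑ μ ∈ g.support, ((μ : ℂ) • w μ : W μ) := by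
      rw [Finsupp.sum, map_sum]
      refine Finset.sum_congr rfl fun μ _ => ?_
      exact Module.End.mem_eigenspace_iff.1 (hg μ)
    have h3 : ‖A (g.sum fun _ x => x)‖ ^ 2 = ∑ μ ∈ g.support, ‖(μ : ℂ) • g μ‖ ^ 2 := by
      rw [h2]; exact hortho.norm_sum (fun μ => (μ : ℂ) • w μ) g.support
    refine le_of_sq_le_sq ?_ (norm_nonneg _)
    rw [mul_pow, h1, h3, Finset.mul_sum]
    refine Finset.sum_le_sum fun μ _ => ?_
    rw [norm_smul, mul_pow]
    have := μ.2
    gcongr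
  have hcard : ∀ (ι : Type) [Fintype ι] (v : ι → V), Orthonormal ℂ v →
      (Fintype.card ι : ℝ) * θ ^ 2 ≤ C := by
    intro ι _ v hv
    have h1 : Orthonormal ℂ (fun i => (v i : H)) := hv.comp_linearIsometry V.subtypeₗᵢ
    refine le_trans ?_ (hC ι _ h1)
    rw [← nsmul_eq_mul, ← Finset.card_univ, ← Finset.sum_const]
    refine Finset.sum_le_sum fun i _ => ?_
    have h2 := hlow (v i) (v i).2
    rw [h1.1 i, mul_one] at h2
    gcongr
  have hfin : FiniteDimensional ℂ V := by
    by_contra hinf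
    obtain ⟨n, hn⟩ := exists_nat_gt (C / θ ^ 2)
    obtain ⟨s, hs⟩ : ∃ v : Fin n → V, LinearIndependent ℂ v := by
      have h1 : Cardinal.aleph0 ≤ Module.rank ℂ V := by
        rw [← not_lt, Module.rank_lt_aleph0_iff]; exact hinf
      have h2 : (n : Cardinal) ≤ Module.rank ℂ V := (Cardinal.natCast_le_aleph0).trans h1
      rw [le_rank_iff_exists_linearIndependent_finset] at h2
      obtain ⟨t, ht, hli⟩ := h2
      exact ⟨fun i => (t.equivFin.symm (Fin.cast ht.symm i) : V),
        hli.comp _ (t.equivFin.symm.injective.comp (Fin.cast_injective _))⟩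
    have h3 := hcard _ _ (InnerProductSpace.gramSchmidtNormed_orthonormal hs)
    rw [Fintype.card_fin, ← le_div_iff₀ (by positivity)] at h3
    linarith
  refine ⟨V, hfin, ?_, ?_⟩
  · have := hcard _ _ (stdOrthonormalBasis ℂ V).orthonormal
    rwa [Fintype.card_fin] at this
  have hVinv : ∀ f ∈ V, A f ∈ V := by
    intro f hf
    refine Submodule.iSup_induction W (motive := fun f => A f ∈ V) hf ?_ ?_ ?_
    · intro μ x hx
      have : A x = (μ : ℂ) • x := Module.End.mem_eigenspace_iff.1 hx
      rw [this]
      exact V.smul_mem _ (Submodule.mem_iSup_of_mem μ hx)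
    · simp
    · intro x y hx hy; rw [map_add]; exact V.add_mem hx hy
  have hinv : ∀ f ∈ Vᗮ, (A : H →ₗ[ℂ] H) f ∈ Vᗮ := by
    intro f hf u hu
    have : ⟪u, A f⟫_ℂ = ⟪A u, f⟫_ℂ := (hsym u f).symm
    exact this.trans (hf _ (hVinv u hu))
  set B : Vᗮ →L[ℂ] Vᗮ := A.restrict hinv
  have hB : IsCompactOperator B := hcomp.restrict' hinv
  have hBs : IsSelfAdjoint B := (show B.IsSymmetric from hsym.restrict_invariant hinv).isSelfAdjoint
  -- A self-adjoint operator has norm equal to its spectral radius, and the nonzero spectrum of a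
  -- compact one consists of eigenvalues. An eigenvector of `B` with eigenvalue beyond `θ` would lie
  -- in both `V` and `Vᗮ`.
  have hBnorm : ‖B‖ ≤ θ := by
    have h1 := B.spectralRadius_eq_nnnorm hBs
    have h2 : spectralRadius ℂ B ≤ ENNReal.ofReal θ := by
      rw [spectralRadius]
      refine iSup₂_le fun μ hμ => ?_
      rcases eq_or_ne μ 0 with rfl | h0
      · simp
      rw [← hB.hasEigenvalue_iff_mem_spectrum h0] at hμ
      obtain ⟨x, hx⟩ := hμ.exists_hasEigenvector
      have hAx : A (x : H) = μ • (x : H) := congrArg Subtype.val hx.apply_eq_smul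
      have hle : ‖μ‖ ≤ θ := by
        by_contra hlt
        have hxV : (x : H) ∈ V := Submodule.mem_iSup_of_mem (⟨μ, not_le.1 hlt⟩ : {μ : ℂ // θ < ‖μ‖})
          (Module.End.mem_eigenspace_iff.2 hAx)
        have : ⟪(x : H), (x : H)⟫_ℂ = 0 := x.2 _ hxV
        rw [inner_self_eq_zero] at this
        exact hx.2 (Subtype.ext this)
      rw [← enorm_eq_nnnorm, ← ofReal_norm]
      exact ENNReal.ofReal_le_ofReal hle
    rw [h1, ← enorm_eq_nnnorm, ← ofReal_norm] at h2
    exact (ENNReal.ofReal_le_ofReal_iff hθ.le).1 h2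
  have hstep : ∀ f ∈ Vᗮ, A f ∈ Vᗮ ∧ ‖A f‖ ≤ θ * ‖f‖ := fun f hf =>
    ⟨hinv f hf, (B.le_of_opNorm_le hBnorm ⟨f, hf⟩ :)⟩
  intro j
  induction j with
  | zero => intro f _; simp
  | succ j ih =>
    intro f hf
    have h1 : (A ^ (j + 1)) f = (A ^ j) (A f) := by rw [pow_succ]; rfl
    rw [h1]
    calc _ ≤ θ ^ j * ‖A f‖ := ih _ (hstep f hf).1
      _ ≤ θ ^ j * (θ * ‖f‖) := by gcongr; exact (hstep f hf).2
      _ = _ := by ring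

end Hilbert

end ZeroRange

namespace ZeroRange

open scoped InnerProductSpace

/-! ### Counting singular values through the sesquilinear form -/

section SingularValues

variable {H : Type*} [NormedAddCommGroup H] [InnerProductSpace ℂ H] [CompleteSpace H]

theorem singularValue_nonneg (T : H →L[ℂ] H) (n : ℕ) : 0 ≤ singularValue T n :=
  Real.sInf_nonneg fun _ hs => hs.1

/-- On the span of the singular spaces for singular values above `ε`, the operator increases norms
by a factor larger than `ε`. -/
theorem eq_zero_of_mem_iSup_singularSpace {T : H →L[ℂ] H} {ε : ℝ} (hε : 0 ≤ ε) {f : H}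
    (hf : f ∈ ⨆ t : Set.Ioi ε, singularSpace T t) (hle : ‖T f‖ ≤ ε * ‖f‖) : f = 0 := by
  have hsym : ((T.adjoint ∘L T : H →L[ℂ] H) : H →ₗ[ℂ] H).IsSymmetric := by
    intro x y
    simp [ContinuousLinearMap.adjoint_inner_left, ContinuousLinearMap.adjoint_inner_right]
  have hortho : OrthogonalFamily ℂ (fun t : Set.Ioi ε => singularSpace T t)
      fun t => (singularSpace T t).subtypeₗᵢ := by
    refine hsym.orthogonalFamily_eigenspaces.comp (f := fun t : Set.Ioi ε => ((t : ℝ) : ℂ) ^ 2) ?_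
    intro s t hst
    have h0 : ((s : ℝ) : ℂ) ^ 2 = ((t : ℝ) : ℂ) ^ 2 := hst
    have h1 : (s : ℝ) ^ 2 = (t : ℝ) ^ 2 := by exact_mod_cast h0
    exact Subtype.ext ((sq_eq_sq₀ (hε.trans s.2.le) (hε.trans t.2.le)).1 h1)
  rw [Submodule.mem_iSup_iff_exists_finsupp] at hf
  obtain ⟨g, hg, rfl⟩ := hf
  set w : ∀ t : Set.Ioi ε, singularSpace T t := fun t => ⟨g t, hg t⟩
  have h1 : ‖g.sum fun _ x => x‖ ^ 2 = ∑ t ∈ g.support, ‖g t‖ ^ 2 := hortho.norm_sum w g.support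
  have h2 : (T.adjoint ∘L T) (g.sum fun _ x => x) =
      ∑ t ∈ g.support, ((((t : ℝ) : ℂ) ^ 2 • w t : singularSpace T t) : H) := by
    rw [Finsupp.sum, map_sum]
    refine Finset.sum_congr rfl fun t _ => ?_
    exact Module.End.mem_eigenspace_iff.1 (hg t)
  have h3 : ‖T (g.sum fun _ x => x)‖ ^ 2 = ∑ t ∈ g.support, (t : ℝ) ^ 2 * ‖g t‖ ^ 2 := by
    have h4 : ⟪g.sum fun _ x => x, (T.adjoint ∘L T) (g.sum fun _ x => x)⟫_ℂ =
        ∑ t ∈ g.support, ⟪w t, ((t : ℝ) : ℂ) ^ 2 • w t⟫_ℂ := by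
      rw [h2]; exact hortho.inner_sum w (fun t => ((t : ℝ) : ℂ) ^ 2 • w t) g.support
    rw [ContinuousLinearMap.comp_apply, ContinuousLinearMap.adjoint_inner_right,
      inner_self_eq_norm_sq_to_K] at h4
    have h5 : ∀ t : Set.Ioi ε, ⟪w t, ((t : ℝ) : ℂ) ^ 2 • w t⟫_ℂ =
        (((t : ℝ) ^ 2 * ‖g t‖ ^ 2 : ℝ) : ℂ) := by
      intro t
      rw [inner_smul_right, inner_self_eq_norm_sq_to_K]
      simp [w]
    simp only [h5, Complex.coe_algebraMap] at h4
    exact_mod_cast h4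
  -- All coefficients are strictly positive because `t > ε`, so every component must vanish.
  have h6 : ∑ t ∈ g.support, ((t : ℝ) ^ 2 - ε ^ 2) * ‖g t‖ ^ 2 ≤ 0 := by
    simp only [sub_mul, Finset.sum_sub_distrib, ← Finset.mul_sum]
    rw [← h3, ← h1, ← mul_pow, sub_nonpos]
    gcongr
  have hpos : ∀ t : Set.Ioi ε, 0 < (t : ℝ) ^ 2 - ε ^ 2 := fun t => by
    have := t.2
    rw [Set.mem_Ioi] at this
    nlinarith
  have h7 : ∀ t ∈ g.support, ((t : ℝ) ^ 2 - ε ^ 2) * ‖g t‖ ^ 2 = 0 :=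
    (Finset.sum_eq_zero_iff_of_nonneg fun t _ => mul_nonneg (hpos t).le (sq_nonneg _)).1
      (le_antisymm h6 (Finset.sum_nonneg fun t _ => mul_nonneg (hpos t).le (sq_nonneg _)))
  refine Finset.sum_eq_zero fun t ht => ?_
  have h8 := (mul_eq_zero.1 (h7 t ht)).resolve_left (hpos t).ne'
  simpa using h8

/-- If the sesquilinear form of `T` is at most `ε` off a subspace of dimension `d`, at most `2 d`
singular values of `T` exceed `ε`. -/
theorem singularValue_le {T : H →L[ℂ] H} {V : Submodule ℂ H} [FiniteDimensional ℂ V] {ε : ℝ}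
    (hε : 0 ≤ ε) (h : ∀ u ∈ Vᗮ, ∀ f ∈ Vᗮ, ‖⟪u, T f⟫_ℂ‖ ≤ ε * (‖u‖ * ‖f‖)) {n : ℕ}
    (hn : 2 * Module.finrank ℂ V ≤ n) : singularValue T n ≤ ε := by
  refine csInf_le ⟨0, fun s hs => hs.1⟩ ⟨hε, ?_⟩
  set W : Submodule ℂ H := ⨆ t : Set.Ioi ε, singularSpace T t
  -- Both `f` and `T f` have to be orthogonal to `V` before the form bound applies to ⟨T f, T f⟩.
  -- This costs two copies of `V`, hence the factor 2 in the count.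
  let L : W →ₗ[ℂ] V × V :=
    ((V.orthogonalProjectionOnto : H →ₗ[ℂ] V).prod
      ((V.orthogonalProjectionOnto : H →ₗ[ℂ] V) ∘ₗ (T : H →ₗ[ℂ] H))) ∘ₗ W.subtype
  have hL : Function.Injective L := by
    rw [← LinearMap.ker_eq_bot, LinearMap.ker_eq_bot']
    intro f hf
    have h1 : V.orthogonalProjectionOnto (f : H) = 0 := congrArg Prod.fst hf
    have h2 : V.orthogonalProjectionOnto (T (f : H)) = 0 := congrArg Prod.snd hf
    rw [Submodule.orthogonalProjectionOnto_eq_zero_iff] at h1 h2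
    have h3 := h _ h2 _ h1
    rw [inner_self_eq_norm_sq_to_K] at h3
    simp only [Complex.coe_algebraMap, norm_pow, Complex.norm_real, norm_norm] at h3
    have h4 : ‖T (f : H)‖ ≤ ε * ‖(f : H)‖ := by
      rcases (norm_nonneg (T (f : H))).eq_or_lt with h5 | h5
      · rw [← h5]; positivity
      · nlinarith
    exact Subtype.ext (eq_zero_of_mem_iSup_singularSpace hε f.2 h4)
  refine (LinearMap.rank_le_of_injective L hL).trans ?_
  rw [← Module.finrank_eq_rank, Module.finrank_prod]
  exact_mod_cast (by omega : _ ≤ n)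

theorem isCompactOperator_of_form_le {T : H →L[ℂ] H}
    (h : ∀ ε > 0, ∃ V : Submodule ℂ H, FiniteDimensional ℂ V ∧
      ∀ u ∈ Vᗮ, ∀ f ∈ Vᗮ, ‖⟪u, T f⟫_ℂ‖ ≤ ε * (‖u‖ * ‖f‖)) : IsCompactOperator T := by
  refine isCompactOperator_of_forall_norm_le T fun ε hε => ?_
  obtain ⟨V, hV, hb⟩ := h ε hε
  set Q := V.starProjection
  -- What remains after subtracting this compact operator is (1 - Q) T (1 - Q), whose form only sees
  -- `Vᗮ`.
  refine ⟨T ∘L Q + Q ∘L (T - T ∘L Q), ?_, ?_⟩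
  · have h1 : IsCompactOperator ((1 : H →L[ℂ] H) ∘L Q) := isCompactOperator_comp_starProjection 1 V
    exact (isCompactOperator_comp_starProjection T V).add (h1.comp_clm (T - T ∘L Q))
  · refine ContinuousLinearMap.opNorm_le_bound _ hε.le fun f => ?_
    have hperp : ∀ g : H, g - Q g ∈ Vᗮ := fun g => V.sub_starProjection_mem_orthogonal g
    have hnorm : ∀ g : H, ‖g - Q g‖ ≤ ‖g‖ := fun g => by
      rw [← Submodule.starProjection_orthogonal_val]
      exact Submodule.norm_starProjection_apply_le _ g
    set g := f - Q f
    set v := T g - Q (T g)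
    have h2 : (T - (T ∘L Q + Q ∘L (T - T ∘L Q))) f = v := by
      simp only [v, g, sub_apply, add_apply,
        ContinuousLinearMap.comp_apply, map_sub]
      abel
    rw [h2]
    have h3 : ⟪v, v⟫_ℂ = ⟪v, T g⟫_ℂ := by
      conv_lhs => rw [show v = T g - Q (T g) from rfl, inner_sub_right]
      rw [show ⟪v, Q (T g)⟫_ℂ = 0 from
        Submodule.inner_left_of_mem_orthogonal (V.starProjection_apply_mem _) (hperp _), sub_zero]
    have h4 := hb v (hperp _) g (hperp _)
    rw [← h3, inner_self_eq_norm_sq_to_K] at h4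
    simp only [Complex.coe_algebraMap, norm_pow, Complex.norm_real, norm_norm] at h4
    have h5 : ‖v‖ ≤ ε * ‖g‖ := by
      rcases (norm_nonneg v).eq_or_lt with h5 | h5
      · rw [← h5]; positivity
      · nlinarith
    exact h5.trans (by gcongr; exact hnorm f)

/-- If for all `N ≥ 1` the form of `T` is `O(N ^ (-γ))` off a subspace of dimension `O(N³)`, then
`T` belongs to the Schatten classes with exponent above `3 / γ`. -/
theorem isSchatten_of_form_le {T : H →L[ℂ] H} {γ C : ℝ} (hγ : 0 < γ) (hC : 0 ≤ C) (D : ℕ)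
    (h : ∀ N : ℕ, 0 < N → ∃ V : Submodule ℂ H, FiniteDimensional ℂ V ∧
      Module.finrank ℂ V ≤ D * N ^ 3 ∧
      ∀ u ∈ Vᗮ, ∀ f ∈ Vᗮ, ‖⟪u, T f⟫_ℂ‖ ≤ C * (N : ℝ) ^ (-γ) * (‖u‖ * ‖f‖))
    {p : ℝ} (hp : 3 / γ < p) : IsSchatten p T := by
  have hp0 : 0 < p := lt_trans (by positivity) hp
  refine ⟨isCompactOperator_of_form_le fun ε hε => ?_, ?_⟩
  · have h1 : Filter.Tendsto (fun N : ℕ => C * (N : ℝ) ^ (-γ)) Filter.atTop (nhds (C * 0)) :=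
      ((tendsto_rpow_neg_atTop hγ).comp tendsto_natCast_atTop_atTop).const_mul C
    rw [mul_zero] at h1
    obtain ⟨N, hN, hN0⟩ := ((h1.eventually_lt_const hε).and (Filter.eventually_gt_atTop 0)).exists
    obtain ⟨V, hV, -, hb⟩ := h N hN0
    exact ⟨V, hV, fun u hu f hf => (hb u hu f hf).trans (by gcongr)⟩
  -- `M` dominates the `2 * D` of the count and stays positive when `D = 0`. With `N` the largest
  -- integer such that `M * N ^ 3 ≤ n`, the subspace for `N` is admissible for the index `n`, while
  -- n < M (N+1)³ ≤ 8 M N³ converts powers of `N` into powers of `n`.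
  · set M : ℕ := 2 * D + 1
    have hbound : ∀ n : ℕ, M ≤ n →
        singularValue T n ≤ C * (8 * M : ℝ) ^ (γ / 3) * (n : ℝ) ^ (-(γ / 3)) := by
      intro n hn
      set N : ℕ := Nat.findGreatest (fun N => M * N ^ 3 ≤ n) n
      have hN1 : 1 ≤ N := Nat.le_findGreatest (by omega) (by simpa using hn)
      have hN2 : M * N ^ 3 ≤ n :=
        Nat.findGreatest_spec (P := fun N => M * N ^ 3 ≤ n) (m := 1) (by omega) (by simpa using hn)
      have hN3 : n < M * (N + 1) ^ 3 := by
        by_contra hlt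
        rw [not_lt] at hlt
        have h1 : N + 1 ≤ n := by
          refine le_trans ?_ hlt
          calc N + 1 ≤ (N + 1) ^ 3 := Nat.le_self_pow (by norm_num) _
            _ ≤ M * (N + 1) ^ 3 := Nat.le_mul_of_pos_left _ (by omega)
        have := Nat.le_findGreatest (P := fun N => M * N ^ 3 ≤ n) h1 hlt
        exact absurd this (by simp [N])
      obtain ⟨V, hV, hd, hb⟩ := h N hN1
      have h2 := singularValue_le (by positivity) hb (n := n) (by
        have : D * N ^ 3 * 2 ≤ M * N ^ 3 := by
          have : D * N ^ 3 * 2 = (2 * D) * N ^ 3 := by ring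
          rw [this]; gcongr; omega
        omega)
      refine h2.trans ?_
      rw [mul_assoc]
      gcongr
      have hNpos : (0 : ℝ) < N := by exact_mod_cast hN1
      have hnpos : (0 : ℝ) < n := by exact_mod_cast (by omega : 0 < n)
      have h3 : (n : ℝ) ≤ 8 * M * (N : ℝ) ^ 3 := by
        have h4 : n ≤ 8 * M * N ^ 3 := by
          refine hN3.le.trans ?_
          calc M * (N + 1) ^ 3 ≤ M * (2 * N) ^ 3 := by gcongr; omega
            _ = 8 * M * N ^ 3 := by ring
        exact_mod_cast h4
      have hMpos : (0 : ℝ) < 8 * M := by simp [M]; positivity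
      have h5 : (n : ℝ) ^ (γ / 3) ≤ (8 * M : ℝ) ^ (γ / 3) * (N : ℝ) ^ γ := by
        calc (n : ℝ) ^ (γ / 3) ≤ (8 * M * (N : ℝ) ^ 3) ^ (γ / 3) := by gcongr
          _ = (8 * M : ℝ) ^ (γ / 3) * (N : ℝ) ^ γ := by
            rw [Real.mul_rpow hMpos.le (by positivity), ← Real.rpow_natCast (N : ℝ) 3,
              ← Real.rpow_mul hNpos.le]
            congr 2
            push_cast; ring
      rw [Real.rpow_neg hNpos.le, Real.rpow_neg hnpos.le, ← div_eq_mul_inv,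
        inv_le_iff_one_le_mul₀ (by positivity), div_mul_eq_mul_div, le_div_iff₀ (by positivity),
        one_mul]
      exact h5
    have hs : Summable fun n : ℕ => (C * (8 * M : ℝ) ^ (γ / 3)) ^ p * (n : ℝ) ^ (-(γ / 3) * p) := by
      refine Summable.mul_left _ (Real.summable_nat_rpow.2 ?_)
      rw [div_lt_iff₀ hγ] at hp
      linarith
    rw [← summable_nat_add_iff M] at hs ⊢
    refine Summable.of_nonneg_of_le (fun n => Real.rpow_nonneg (singularValue_nonneg _ _) _)
      (fun n => ?_) hs
    refine (Real.rpow_le_rpow (singularValue_nonneg _ _) (hbound (n + M) (by omega)) hp0.le).trans ?_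
    rw [Real.mul_rpow (by positivity) (by positivity), ← Real.rpow_mul (by positivity)]

end SingularValues

end ZeroRange

namespace ZeroRange

open scoped InnerProductSpace

/-! ### Decay of powers of the resolvent from decay of the semigroup -/

section Resolvent

variable {H K : Type*} [NormedAddCommGroup H] [InnerProductSpace ℂ H]
  [NormedAddCommGroup K] [InnerProductSpace ℂ K]

/-- Take `u = v`. The operators `G` and `P` are only known as weak integrals, and this turns bounds
on their forms into norm bounds. -/
theorem norm_le_of_forall_norm_inner_le {v : K} {c : ℝ} (hc : 0 ≤ c)
    (h : ∀ u : K, ‖⟪u, v⟫_ℂ‖ ≤ c * ‖u‖) : ‖v‖ ≤ c := by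
  have h3 := h v
  rw [inner_self_eq_norm_sq_to_K] at h3
  simp only [Complex.coe_algebraMap, norm_pow, Complex.norm_real, norm_norm] at h3
  rcases (norm_nonneg v).eq_or_lt with h5 | h5
  · rw [← h5]; exact hc
  · nlinarith

theorem integrableOn_rpow_mul_exp {a : ℝ} (ha : 0 < a) :
    IntegrableOn (fun t : ℝ => t ^ (-(3 / 4) : ℝ) * Real.exp (-a * t)) (Set.Ioi 0) := by
  simpa using integrableOn_rpow_mul_exp_neg_mul_rpow (p := 1) (s := -(3 / 4)) (b := a)
    (by norm_num) (by norm_num) ha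

theorem integral_rpow_mul_exp {a : ℝ} (ha : 0 < a) :
    ∫ t in Set.Ioi (0 : ℝ), t ^ (-(3 / 4) : ℝ) * Real.exp (-a * t) =
      a ^ (-(1 / 4) : ℝ) * Real.Gamma (1 / 4) := by
  have h := Real.integral_rpow_mul_exp_neg_mul_Ioi (a := 1 / 4) (by norm_num) ha
  rw [one_div a, Real.inv_rpow ha.le, ← Real.rpow_neg ha.le] at h
  norm_num at h ⊢
  exact h

theorem integrableOn_exp_neg {a : ℝ} (ha : 0 < a) :
    IntegrableOn (fun t : ℝ => Real.exp (-a * t)) (Set.Ioi 0) :=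
  integrableOn_exp_mul_Ioi (by linarith) 0

theorem integral_exp_neg {a : ℝ} (ha : 0 < a) :
    ∫ t in Set.Ioi (0 : ℝ), Real.exp (-a * t) = 1 / a := by
  rw [integral_exp_mul_Ioi (by linarith)]; simp [neg_div_neg_eq]

theorem norm_setIntegral_Ioi_le {F : ℝ → ℂ} {g : ℝ → ℝ} (hg : IntegrableOn g (Set.Ioi 0))
    (h : ∀ t, 0 < t → ‖F t‖ ≤ g t) :
    ‖∫ t in Set.Ioi (0 : ℝ), F t‖ ≤ ∫ t in Set.Ioi (0 : ℝ), g t :=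
  norm_integral_le_of_norm_le hg ((ae_restrict_mem measurableSet_Ioi).mono fun t ht => h t ht)

variable {lam : ℝ} {G : K →L[ℂ] K} {P : H →L[ℂ] K} {S : ℝ → K →L[ℂ] K} {E : ℝ → H →L[ℂ] K}

/-- One more factor `G` replaces E_t by the integral of exp(-λs) E_{s+t} over s. As (s+t)^{-3/4} ≤
t^{-3/4}, the decaying part is multiplied by at most ∫ exp(-as) ds = 1/a, where exp(-λs) is bounded
by 1. The constant part has only exp(-λs) to make it integrable, and gains 1/λ. -/
theorem norm_resolvent_pow_apply_le [CompleteSpace K] (hlam : 0 < lam)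
    (hG : ∀ u v : K, ⟪u, G v⟫_ℂ =
      ∫ t in Set.Ioi (0 : ℝ), (Real.exp (-lam * t) : ℂ) * ⟪u, S t v⟫_ℂ)
    (hSE : ∀ s t, 0 < s → 0 < t → ∀ f, S s (E t f) = E (s + t) f)
    {f : H} {a A B : ℝ} (ha : 0 < a) (hA : 0 ≤ A) (hB : 0 ≤ B)
    (hf : ∀ t, 0 < t → ‖E t f‖ ≤ A * (t ^ (-(3 / 4) : ℝ) * Real.exp (-a * t)) + B) (m : ℕ) :
    ∀ t, 0 < t → ‖(G ^ m) (E t f)‖ ≤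
      A / a ^ m * (t ^ (-(3 / 4) : ℝ) * Real.exp (-a * t)) + B / lam ^ m := by
  induction m with
  | zero => simpa using hf
  | succ m ih =>
    intro t ht
    have hAm : 0 ≤ A / a ^ m := by positivity
    have hBm : 0 ≤ B / lam ^ m := by positivity
    refine norm_le_of_forall_norm_inner_le (by positivity) fun u => ?_
    have h1 : ⟪u, (G ^ (m + 1)) (E t f)⟫_ℂ =
        ∫ s in Set.Ioi (0 : ℝ), (Real.exp (-lam * s) : ℂ) * ⟪u, (G ^ m) (S s (E t f))⟫_ℂ := by
      rw [pow_succ, mul_apply_eq_comp, ← ContinuousLinearMap.adjoint_inner_left, hG]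
      simp only [ContinuousLinearMap.adjoint_inner_left]
    rw [h1]
    have hint : IntegrableOn (fun s : ℝ =>
        (A / a ^ m * (t ^ (-(3 / 4) : ℝ) * Real.exp (-a * t)) * ‖u‖) * Real.exp (-a * s) +
          (B / lam ^ m * ‖u‖) * Real.exp (-lam * s)) (Set.Ioi 0) :=
      ((integrableOn_exp_neg ha).const_mul _).add ((integrableOn_exp_neg hlam).const_mul _)
    refine (norm_setIntegral_Ioi_le hint fun s hs => ?_).trans_eq ?_
    · rw [norm_mul, Complex.norm_real, Real.norm_of_nonneg (Real.exp_pos _).le, hSE s t hs ht]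
      have h2 := ih (s + t) (by positivity)
      have h3 : (s + t) ^ (-(3 / 4) : ℝ) ≤ t ^ (-(3 / 4) : ℝ) :=
        Real.rpow_le_rpow_of_nonpos ht (by linarith) (by norm_num)
      have h4 : Real.exp (-a * (s + t)) = Real.exp (-a * t) * Real.exp (-a * s) := by
        rw [← Real.exp_add]; ring_nf
      have h5 : Real.exp (-lam * s) ≤ 1 := by
        rw [Real.exp_le_one_iff]; nlinarith
      calc Real.exp (-lam * s) * ‖⟪u, (G ^ m) (E (s + t) f)⟫_ℂ‖
          ≤ Real.exp (-lam * s) * (‖u‖ * ‖(G ^ m) (E (s + t) f)‖) := by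
            gcongr; exact norm_inner_le_norm _ _
        _ ≤ Real.exp (-lam * s) * (‖u‖ * (A / a ^ m * (t ^ (-(3 / 4) : ℝ) *
              (Real.exp (-a * t) * Real.exp (-a * s))) + B / lam ^ m)) := by
            rw [← h4]
            gcongr
            refine h2.trans ?_
            gcongr
        _ = Real.exp (-lam * s) * (A / a ^ m * (t ^ (-(3 / 4) : ℝ) *
              Real.exp (-a * t)) * ‖u‖ * Real.exp (-a * s)) +
              B / lam ^ m * ‖u‖ * Real.exp (-lam * s) := by ring
        _ ≤ _ := add_le_add (mul_le_of_le_one_left (by positivity) h5) le_rfl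
    · rw [integral_add ((integrableOn_exp_neg ha).const_mul _)
        ((integrableOn_exp_neg hlam).const_mul _), integral_const_mul, integral_const_mul,
        integral_exp_neg ha, integral_exp_neg hlam]
      field_simp
      ring

/-- The last integration, over the time in `P`, meets the singularity t^{-3/4} itself: ∫ t^{-3/4}
exp(-at) dt = Γ(1/4) a^{-1/4}, which supplies the extra quarter in the exponent. -/
theorem norm_resolvent_pow_potential_le [CompleteSpace K] (hlam : 0 < lam)
    (hG : ∀ u v : K, ⟪u, G v⟫_ℂ =
      ∫ t in Set.Ioi (0 : ℝ), (Real.exp (-lam * t) : ℂ) * ⟪u, S t v⟫_ℂ)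
    (hP : ∀ (u : K) (f : H), ⟪u, P f⟫_ℂ =
      ∫ t in Set.Ioi (0 : ℝ), (Real.exp (-lam * t) : ℂ) * ⟪u, E t f⟫_ℂ)
    (hSE : ∀ s t, 0 < s → 0 < t → ∀ f, S s (E t f) = E (s + t) f)
    {f : H} {a A B : ℝ} (ha : 0 < a) (hA : 0 ≤ A) (hB : 0 ≤ B)
    (hf : ∀ t, 0 < t → ‖E t f‖ ≤ A * (t ^ (-(3 / 4) : ℝ) * Real.exp (-a * t)) + B) (m : ℕ) :
    ‖(G ^ m) (P f)‖ ≤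
      A * (Real.Gamma (1 / 4) * a ^ (-(m + 1 / 4) : ℝ)) + B / lam ^ (m + 1) := by
  have hgam : 0 < Real.Gamma (1 / 4) := Real.Gamma_pos_of_pos (by norm_num)
  have hbase := norm_resolvent_pow_apply_le hlam hG hSE ha hA hB hf m
  refine norm_le_of_forall_norm_inner_le (by positivity) fun u => ?_
  have h1 : ⟪u, (G ^ m) (P f)⟫_ℂ =
      ∫ s in Set.Ioi (0 : ℝ), (Real.exp (-lam * s) : ℂ) * ⟪u, (G ^ m) (E s f)⟫_ℂ := by
    rw [← ContinuousLinearMap.adjoint_inner_left, hP]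
    simp only [ContinuousLinearMap.adjoint_inner_left]
  rw [h1]
  have hint : IntegrableOn (fun s : ℝ =>
      (A / a ^ m * ‖u‖) * (s ^ (-(3 / 4) : ℝ) * Real.exp (-a * s)) +
        (B / lam ^ m * ‖u‖) * Real.exp (-lam * s)) (Set.Ioi 0) :=
    ((integrableOn_rpow_mul_exp ha).const_mul _).add ((integrableOn_exp_neg hlam).const_mul _)
  refine (norm_setIntegral_Ioi_le hint fun s hs => ?_).trans_eq ?_
  · rw [norm_mul, Complex.norm_real, Real.norm_of_nonneg (Real.exp_pos _).le]
    have h5 : Real.exp (-lam * s) ≤ 1 := by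
      rw [Real.exp_le_one_iff]; nlinarith
    calc Real.exp (-lam * s) * ‖⟪u, (G ^ m) (E s f)⟫_ℂ‖
        ≤ Real.exp (-lam * s) * (‖u‖ * (A / a ^ m * (s ^ (-(3 / 4) : ℝ) *
            Real.exp (-a * s)) + B / lam ^ m)) := by
          gcongr
          exact (norm_inner_le_norm _ _).trans (by gcongr; exact hbase s hs)
      _ = Real.exp (-lam * s) * (A / a ^ m * ‖u‖ * (s ^ (-(3 / 4) : ℝ) * Real.exp (-a * s))) +
            B / lam ^ m * ‖u‖ * Real.exp (-lam * s) := by ring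
      _ ≤ _ := add_le_add (mul_le_of_le_one_left (by positivity) h5) le_rfl
  · rw [integral_add ((integrableOn_rpow_mul_exp ha).const_mul _)
      ((integrableOn_exp_neg hlam).const_mul _), integral_const_mul, integral_const_mul,
      integral_rpow_mul_exp ha, integral_exp_neg hlam, neg_add, Real.rpow_add ha,
      Real.rpow_neg ha.le (m : ℝ), Real.rpow_natCast]
    field_simp
    ring

/-- The exponential series gives exp(-x) ≤ (m+1)!/x^{m+1}, and m+1 exceeds m+1/4. The remainder
exp(-cN) is thus absorbed into the main rate. -/
theorem exists_exp_neg_le_rpow {c : ℝ} (hc : 0 < c) (m : ℕ) :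
    ∃ D : ℝ, 0 ≤ D ∧ ∀ N : ℕ, 0 < N →
      Real.exp (-(c * N)) ≤ D * (N : ℝ) ^ (-(m + 1 / 4) : ℝ) := by
  refine ⟨(m + 1).factorial / c ^ (m + 1), by positivity, fun N hN => ?_⟩
  have hN1 : (1 : ℝ) ≤ N := by exact_mod_cast hN
  have hN0 : (0 : ℝ) < N := by positivity
  have h1 := Real.pow_div_factorial_le_exp (c * N) (by positivity) (m + 1)
  have h2 : Real.exp (-(c * N)) ≤ (m + 1).factorial / (c * N) ^ (m + 1) := by
    rw [Real.exp_neg, ← inv_div]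
    exact inv_anti₀ (by positivity) h1
  refine h2.trans ?_
  rw [mul_pow, div_mul_eq_div_div, div_eq_mul_inv _ ((N : ℝ) ^ (m + 1))]
  gcongr
  rw [← Real.rpow_natCast, ← Real.rpow_neg hN0.le]
  refine Real.rpow_le_rpow_of_exponent_le hN1 ?_
  push_cast
  linarith

theorem exists_resolvent_pow_bound [CompleteSpace K] (hlam : 0 < lam)
    (hG : ∀ u v : K, ⟪u, G v⟫_ℂ =
      ∫ t in Set.Ioi (0 : ℝ), (Real.exp (-lam * t) : ℂ) * ⟪u, S t v⟫_ℂ)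
    (hP : ∀ (u : K) (f : H), ⟪u, P f⟫_ℂ =
      ∫ t in Set.Ioi (0 : ℝ), (Real.exp (-lam * t) : ℂ) * ⟪u, E t f⟫_ℂ)
    (hSE : ∀ s t, 0 < s → 0 < t → ∀ f, S s (E t f) = E (s + t) f)
    {c C : ℝ} (hc : 0 < c) (hC : 0 ≤ C) (m : ℕ) :
    ∃ D : ℝ, 0 ≤ D ∧ ∀ (N : ℕ) (f : H), 0 < N →
      (∀ t, 0 < t → ‖E t f‖ ≤ C * (t ^ (-(3 / 4) : ℝ) * Real.exp (-(c * N) * t) +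
        Real.exp (-(c * N))) * ‖f‖) →
      ‖(G ^ m) (P f)‖ ≤ D * (N : ℝ) ^ (-(m + 1 / 4) : ℝ) * ‖f‖ := by
  obtain ⟨D, hD, hexp⟩ := exists_exp_neg_le_rpow hc m
  have hgam : 0 < Real.Gamma (1 / 4) := Real.Gamma_pos_of_pos (by norm_num)
  refine ⟨C * (Real.Gamma (1 / 4) * c ^ (-(m + 1 / 4) : ℝ)) + C * D / lam ^ (m + 1),
    by positivity, fun N f hN hf => ?_⟩
  have hN0 : (0 : ℝ) < N := by exact_mod_cast hN
  have h1 := norm_resolvent_pow_potential_le hlam hG hP hSE (f := f) (a := c * N)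
    (A := C * ‖f‖) (B := C * Real.exp (-(c * N)) * ‖f‖) (by positivity) (by positivity)
    (by positivity) (fun t ht => (hf t ht).trans_eq (by ring)) m
  refine h1.trans ?_
  rw [Real.mul_rpow hc.le hN0.le]
  have h2 := hexp N hN
  calc _ ≤ C * ‖f‖ * (Real.Gamma (1 / 4) * (c ^ (-(m + 1 / 4) : ℝ) * (N : ℝ) ^ (-(m + 1 / 4) : ℝ)))
        + C * (D * (N : ℝ) ^ (-(m + 1 / 4) : ℝ)) * ‖f‖ / lam ^ (m + 1) := by gcongr
    _ = _ := by ring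

/-- The abstract form of the theorem: `G` and `P` are Laplace transforms of `S` and `E`, and off a
subspace of dimension `O(N³)` the operators `E t` decay like `t ^ (-3/4) exp (-c N t)`. -/
theorem isSchatten_adjoint_comp_pow_comp [CompleteSpace H]
    [CompleteSpace K] (hlam : 0 < lam)
    (hG : ∀ u v : K, ⟪u, G v⟫_ℂ =
      ∫ t in Set.Ioi (0 : ℝ), (Real.exp (-lam * t) : ℂ) * ⟪u, S t v⟫_ℂ)
    (hP : ∀ (u : K) (f : H), ⟪u, P f⟫_ℂ =
      ∫ t in Set.Ioi (0 : ℝ), (Real.exp (-lam * t) : ℂ) * ⟪u, E t f⟫_ℂ)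
    (hSE : ∀ s t, 0 < s → 0 < t → ∀ f, S s (E t f) = E (s + t) f)
    {c C : ℝ} (hc : 0 < c) (hC : 0 ≤ C) (D : ℕ)
    (hV : ∀ N : ℕ, 0 < N → ∃ V : Submodule ℂ H, FiniteDimensional ℂ V ∧
      Module.finrank ℂ V ≤ D * N ^ 3 ∧ ∀ f ∈ Vᗮ, ∀ t, 0 < t →
        ‖E t f‖ ≤ C * (t ^ (-(3 / 4) : ℝ) * Real.exp (-(c * N) * t) +
          Real.exp (-(c * N))) * ‖f‖)
    (k : ℕ) {p : ℝ} (hp : 3 / ((k : ℝ) + 1 / 2) < p) :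
    IsSchatten p (P.adjoint ∘L (G ^ k) ∘L P) := by
  -- The form is ⟨P u, G^k P f⟩: the exponent 0 serves `u` and the exponent `k` serves `f`, and 1/4
  -- + (k + 1/4) = k + 1/2.
  obtain ⟨D₁, hD₁, h₁⟩ := exists_resolvent_pow_bound hlam hG hP hSE hc hC 0
  obtain ⟨D₂, hD₂, h₂⟩ := exists_resolvent_pow_bound hlam hG hP hSE hc hC k
  refine isSchatten_of_form_le (by positivity) (mul_nonneg hD₁ hD₂) D (fun N hN => ?_) hp
  obtain ⟨V, hfin, hdim, hb⟩ := hV N hN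
  refine ⟨V, hfin, hdim, fun u hu f hf => ?_⟩
  have hN0 : (0 : ℝ) < N := by exact_mod_cast hN
  rw [ContinuousLinearMap.comp_apply, ContinuousLinearMap.comp_apply,
    ContinuousLinearMap.adjoint_inner_right]
  refine (norm_inner_le_norm _ _).trans ?_
  calc _ ≤ (D₁ * (N : ℝ) ^ (-((0 : ℕ) + 1 / 4) : ℝ) * ‖u‖) *
          (D₂ * (N : ℝ) ^ (-(k + 1 / 4) : ℝ) * ‖f‖) := by
        gcongr
        · exact h₁ N u hN (hb u hu)
        · exact h₂ N f hN (hb f hf)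
    _ = D₁ * D₂ * ((N : ℝ) ^ (-((0 : ℕ) + 1 / 4) : ℝ) * (N : ℝ) ^ (-(k + 1 / 4) : ℝ)) *
          (‖u‖ * ‖f‖) := by ring
    _ = _ := by
        rw [← Real.rpow_add hN0]
        congr 3
        push_cast
        ring

end Resolvent

end ZeroRange

namespace ZeroRange

open scoped ENNReal

/-! ### L² bounds for nonnegative kernels -/

section KernelBounds

variable {X Y Z : Type*} [MeasurableSpace X] [MeasurableSpace Y] [MeasurableSpace Z]

/-- The `L²` bound for the operator with the nonnegative kernel `κ`. -/
def KernelBound (μ : Measure X) (ν : Measure Y) (κ : Y → X → ℝ≥0∞) (C : ℝ≥0∞) : Prop :=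
  ∀ f : X → ℝ≥0∞, Measurable f →
    ∫⁻ y, (∫⁻ x, κ y x * f x ∂μ) ^ 2 ∂ν ≤ C ^ 2 * ∫⁻ x, f x ^ 2 ∂μ

theorem sq_lintegral_le {m : Measure X} {f : X → ℝ≥0∞} (hf : AEMeasurable f m) :
    (∫⁻ x, f x ∂m) ^ 2 ≤ m Set.univ * ∫⁻ x, f x ^ 2 ∂m := by
  have h := ENNReal.lintegral_mul_le_Lp_mul_Lq m Real.HolderConjugate.two_two hf
    (aemeasurable_const (b := (1 : ℝ≥0∞)))
  simp only [Pi.mul_apply, mul_one, lintegral_const, ENNReal.rpow_two, one_pow, one_mul] at h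
  calc (∫⁻ x, f x ∂m) ^ 2 ≤
      ((∫⁻ x, f x ^ 2 ∂m) ^ (1 / 2 : ℝ) * m Set.univ ^ (1 / 2 : ℝ)) ^ 2 := by gcongr
    _ = _ := by
      rw [mul_pow, ← ENNReal.rpow_two, ← ENNReal.rpow_two, ← ENNReal.rpow_mul, ← ENNReal.rpow_mul]
      norm_num
      rw [mul_comm]

/-- Cauchy–Schwarz against the constant 1, for the measure with density `w`. -/
theorem sq_lintegral_mul_le {m : Measure X} {w f : X → ℝ≥0∞} (hw : Measurable w)
    (hf : Measurable f) :
    (∫⁻ x, w x * f x ∂m) ^ 2 ≤ (∫⁻ x, w x ∂m) * ∫⁻ x, w x * f x ^ 2 ∂m := by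
  have h := sq_lintegral_le (m := m.withDensity w) hf.aemeasurable
  rw [lintegral_withDensity_eq_lintegral_mul _ hw hf,
    lintegral_withDensity_eq_lintegral_mul _ hw (hf.pow_const 2),
    withDensity_apply _ MeasurableSet.univ, setLIntegral_univ] at h
  exact h

variable {μ : Measure X} {ν : Measure Y} {ρ : Measure Z} {κ : Y → X → ℝ≥0∞} {C : ℝ≥0∞}

theorem KernelBound.mono {κ' : Y → X → ℝ≥0∞} (h : KernelBound μ ν κ C)
    (hle : ∀ y x, κ' y x ≤ κ y x) : KernelBound μ ν κ' C := fun f hf =>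
  (lintegral_mono fun y => by
    gcongr with x
    exact hle y x).trans (h f hf)

theorem KernelBound.mono_right {C' : ℝ≥0∞} (h : KernelBound μ ν κ C) (hle : C ≤ C') :
    KernelBound μ ν κ C' := fun f hf =>
  (h f hf).trans (by gcongr)

theorem KernelBound.const_mul (h : KernelBound μ ν κ C) (a : ℝ≥0∞) (ha : a ≠ ∞) :
    KernelBound μ ν (fun y x => a * κ y x) (a * C) := fun f hf => by
  simp only [mul_assoc, lintegral_const_mul' _ _ ha, mul_pow]
  rw [lintegral_const_mul' _ _ (by finiteness)]
  gcongr
  exact h f hf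

/-- The Schur test. -/
theorem kernelBound_of_schur [SFinite μ] [SFinite ν] (hκ : Measurable fun z : Y × X => κ z.1 z.2)
    (h₁ : ∀ y, ∫⁻ x, κ y x ∂μ ≤ C) (h₂ : ∀ x, ∫⁻ y, κ y x ∂ν ≤ C) : KernelBound μ ν κ C := by
  intro f hf
  have hκy : ∀ y, Measurable fun x => κ y x := fun y => hκ.comp measurable_prodMk_left
  have hκx : ∀ x, Measurable fun y => κ y x := fun x => hκ.comp measurable_prodMk_right
  calc ∫⁻ y, (∫⁻ x, κ y x * f x ∂μ) ^ 2 ∂ν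
      ≤ ∫⁻ y, C * ∫⁻ x, κ y x * f x ^ 2 ∂μ ∂ν := by
        refine lintegral_mono fun y => ?_
        refine (sq_lintegral_mul_le (hκy y) hf).trans ?_
        gcongr
        exact h₁ y
    _ = C * ∫⁻ y, ∫⁻ x, κ y x * f x ^ 2 ∂μ ∂ν := by
        refine lintegral_const_mul _ ?_
        exact Measurable.lintegral_prod_right' (f := fun z : Y × X => κ z.1 z.2 * f z.2 ^ 2)
          (hκ.mul ((hf.comp measurable_snd).pow_const 2))
    _ = C * ∫⁻ x, ∫⁻ y, κ y x * f x ^ 2 ∂ν ∂μ := by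
        rw [lintegral_lintegral_swap]
        exact (hκ.mul ((hf.comp measurable_snd).pow_const 2)).aemeasurable
    _ ≤ C * ∫⁻ x, C * f x ^ 2 ∂μ := by
        gcongr with x
        rw [lintegral_mul_const _ (hκx x)]
        gcongr
        exact h₂ x
    _ = _ := by
        rw [lintegral_const_mul _ (hf.pow_const 2), sq, mul_assoc]

/-- A bound for a kernel from a Schur bound for the kernel of `T* T`. -/
theorem kernelBound_of_schur_sq [SFinite μ] [SFinite ν] (hκ : Measurable fun z : Y × X => κ z.1 z.2)
    {D : ℝ≥0∞} (h : ∀ x, ∫⁻ x', ∫⁻ y, κ y x * κ y x' ∂ν ∂μ ≤ D) (hD : 2 * D ≤ C ^ 2) :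
    KernelBound μ ν κ C := by
  intro f hf
  have hκy : ∀ y, Measurable fun x => κ y x := fun y => hκ.comp measurable_prodMk_left
  have hm1 : Measurable fun z : (Y × X) × X => κ z.1.1 z.1.2 := hκ.comp measurable_fst
  have hm2 : Measurable fun z : (Y × X) × X => κ z.1.1 z.2 :=
    hκ.comp ((measurable_fst.comp measurable_fst).prodMk measurable_snd)
  have hmL : Measurable fun z : (X × X) × Y => κ z.2 z.1.1 * κ z.2 z.1.2 :=
    (hκ.comp (measurable_snd.prodMk (measurable_fst.comp measurable_fst))).mul
      (hκ.comp (measurable_snd.prodMk (measurable_snd.comp measurable_fst)))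
  have hL : Measurable fun z : X × X => ∫⁻ y, κ y z.1 * κ y z.2 ∂ν := hmL.lintegral_prod_right'
  have hterm : ∫⁻ x, ∫⁻ x', f x ^ 2 * ∫⁻ y, κ y x * κ y x' ∂ν ∂μ ∂μ ≤ D * ∫⁻ x, f x ^ 2 ∂μ := by
    rw [← lintegral_const_mul _ (hf.pow_const 2)]
    refine lintegral_mono fun x => ?_
    have hLx : Measurable fun x' => ∫⁻ y, κ y x * κ y x' ∂ν := hL.comp measurable_prodMk_left
    rw [lintegral_const_mul _ hLx, mul_comm]
    gcongr
    exact h x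
  have hterm' : ∫⁻ x, ∫⁻ x', f x' ^ 2 * ∫⁻ y, κ y x * κ y x' ∂ν ∂μ ∂μ ≤
      D * ∫⁻ x, f x ^ 2 ∂μ := by
    rw [lintegral_lintegral_swap
      (((hf.comp measurable_snd).pow_const 2).mul hL).aemeasurable]
    refine le_trans (le_of_eq ?_) hterm
    refine lintegral_congr fun x => lintegral_congr fun x' => ?_
    congr 1
    exact lintegral_congr fun y => mul_comm _ _
  calc ∫⁻ y, (∫⁻ x, κ y x * f x ∂μ) ^ 2 ∂ν
      = ∫⁻ y, ∫⁻ z : X × X, (f z.1 * f z.2) * (κ y z.1 * κ y z.2) ∂(μ.prod μ) ∂ν := by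
        refine lintegral_congr fun y => ?_
        have hy : AEMeasurable (fun x => κ y x * f x) μ := ((hκy y).mul hf).aemeasurable
        rw [sq, ← lintegral_prod_mul hy hy]
        refine lintegral_congr fun z => ?_
        ring
    _ = ∫⁻ z : X × X, (f z.1 * f z.2) * ∫⁻ y, κ y z.1 * κ y z.2 ∂ν ∂(μ.prod μ) := by
        rw [lintegral_lintegral_swap]
        · refine lintegral_congr fun z => ?_
          rw [lintegral_const_mul]
          exact (hmL.comp measurable_prodMk_left :)
        · exact ((((hf.comp measurable_fst).mul (hf.comp measurable_snd)).comp measurable_snd).mul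
            (hmL.comp measurable_swap)).aemeasurable
    -- The product of two numbers is at most the sum of their squares. Both terms then have the same
    -- bound, by symmetry of the kernel of T* T, whence the 2 in `hD`.
    _ ≤ ∫⁻ z : X × X, (f z.1 ^ 2 * ∫⁻ y, κ y z.1 * κ y z.2 ∂ν) +
          f z.2 ^ 2 * ∫⁻ y, κ y z.1 * κ y z.2 ∂ν ∂(μ.prod μ) := by
        refine lintegral_mono fun z => ?_
        rw [← add_mul]
        gcongr
        rcases le_total (f z.1) (f z.2) with h | h
        · exact le_add_left (by rw [sq]; gcongr)
        · exact le_add_right (by rw [sq]; gcongr)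
    _ ≤ D * ∫⁻ x, f x ^ 2 ∂μ + D * ∫⁻ x, f x ^ 2 ∂μ := by
        have hm3 : Measurable fun z : X × X => f z.1 ^ 2 * ∫⁻ y, κ y z.1 * κ y z.2 ∂ν :=
          ((hf.comp measurable_fst).pow_const 2).mul hL
        have hm4 : Measurable fun z : X × X => f z.2 ^ 2 * ∫⁻ y, κ y z.1 * κ y z.2 ∂ν :=
          ((hf.comp measurable_snd).pow_const 2).mul hL
        rw [lintegral_add_left hm3, lintegral_prod _ hm3.aemeasurable,
          lintegral_prod _ hm4.aemeasurable]
        exact add_le_add hterm hterm'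
    _ = 2 * D * ∫⁻ x, f x ^ 2 ∂μ := by ring
    _ ≤ _ := by gcongr

/-- A superposition of kernels is bounded by the integral of their bounds. -/
theorem kernelBound_lintegral [SFinite μ] [SFinite ν] [SFinite ρ] {k : Z → Y → X → ℝ≥0∞}
    (hk : Measurable fun z : Z × Y × X => k z.1 z.2.1 z.2.2)
    {c : Z → ℝ≥0∞} (hc : Measurable c) (hc0 : ∀ t, c t ≠ 0) (hctop : ∀ t, c t ≠ ∞)
    (hb : ∀ᵐ t ∂ρ, KernelBound μ ν (k t) (c t)) :
    KernelBound μ ν (fun y x => ∫⁻ t, k t y x ∂ρ) (∫⁻ t, c t ∂ρ) := by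
  intro f hf
  set φ : Z → Y → ℝ≥0∞ := fun t y => ∫⁻ x, k t y x * f x ∂μ
  have hφ : Measurable fun z : Z × Y => φ z.1 z.2 := by
    refine Measurable.lintegral_prod_right' (f := fun z : (Z × Y) × X => k z.1.1 z.1.2 z.2 * f z.2) ?_
    refine Measurable.mul ?_ (hf.comp measurable_snd)
    exact hk.comp ((measurable_fst.comp measurable_fst).prodMk
      ((measurable_snd.comp measurable_fst).prodMk measurable_snd))
  have h1 : ∀ y, ∫⁻ x, (∫⁻ t, k t y x ∂ρ) * f x ∂μ = ∫⁻ t, φ t y ∂ρ := by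
    intro y
    have hm : Measurable fun z : X × Z => k z.2 y z.1 :=
      hk.comp (measurable_snd.prodMk (measurable_const.prodMk measurable_fst))
    rw [lintegral_lintegral_swap (f := fun t x => k t y x * f x)]
    · refine lintegral_congr fun x => ?_
      rw [lintegral_mul_const]
      exact (hm.comp measurable_prodMk_left :)
    · exact ((hm.comp measurable_swap).mul (hf.comp measurable_snd)).aemeasurable
  -- Cauchy–Schwarz with weight `c`, in place of Minkowski's integral inequality: the L² bound of
  -- φ_t² brings `c t ^ 2`, and one factor cancels against the weight.
  have h2 : ∀ y, (∫⁻ t, φ t y ∂ρ) ^ 2 ≤ (∫⁻ t, c t ∂ρ) * ∫⁻ t, (c t)⁻¹ * φ t y ^ 2 ∂ρ := by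
    intro y
    have hφy : Measurable fun t => φ t y := hφ.comp measurable_prodMk_right
    have := sq_lintegral_mul_le (m := ρ) hc (hc.inv.mul hφy)
    refine (le_of_eq ?_).trans (this.trans (le_of_eq ?_))
    · congr 1
      refine lintegral_congr fun t => ?_
      simp only [Pi.mul_apply, Pi.inv_apply]
      rw [← mul_assoc, ENNReal.mul_inv_cancel (hc0 t) (hctop t), one_mul]
    · congr 1
      refine lintegral_congr fun t => ?_
      simp only [Pi.mul_apply, Pi.inv_apply]
      rw [mul_pow, sq (c t)⁻¹, ← mul_assoc, ← mul_assoc, ENNReal.mul_inv_cancel (hc0 t) (hctop t),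
        one_mul]
  have hm5 : Measurable fun z : Z × Y => (c z.1)⁻¹ * φ z.1 z.2 ^ 2 :=
    (hc.inv.comp measurable_fst).mul (hφ.pow_const 2)
  calc ∫⁻ y, (∫⁻ x, (∫⁻ t, k t y x ∂ρ) * f x ∂μ) ^ 2 ∂ν
      ≤ ∫⁻ y, (∫⁻ t, c t ∂ρ) * ∫⁻ t, (c t)⁻¹ * φ t y ^ 2 ∂ρ ∂ν := by
        simp only [h1]
        exact lintegral_mono h2
    _ = (∫⁻ t, c t ∂ρ) * ∫⁻ t, ∫⁻ y, (c t)⁻¹ * φ t y ^ 2 ∂ν ∂ρ := by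
        rw [lintegral_const_mul, lintegral_lintegral_swap]
        · exact (hm5.comp measurable_swap).aemeasurable
        · exact (hm5.comp measurable_swap).lintegral_prod_right'
    _ ≤ (∫⁻ t, c t ∂ρ) * ∫⁻ t, c t * ∫⁻ x, f x ^ 2 ∂μ ∂ρ := by
        refine mul_le_mul_right ?_ _
        refine lintegral_mono_ae (hb.mono fun t ht => ?_)
        have hφt : Measurable fun y => φ t y ^ 2 := (hφ.comp measurable_prodMk_left).pow_const 2
        rw [lintegral_const_mul _ hφt]
        calc _ ≤ (c t)⁻¹ * (c t ^ 2 * ∫⁻ x, f x ^ 2 ∂μ) := by gcongr; exact ht f hf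
          _ = _ := by
            rw [sq, ← mul_assoc, ← mul_assoc, ENNReal.inv_mul_cancel (hc0 t) (hctop t), one_mul]
    _ = _ := by rw [lintegral_mul_const _ hc, sq, mul_assoc]

end KernelBounds

end ZeroRange

namespace ZeroRange

open scoped ENNReal InnerProductSpace ComplexConjugate

/-! ### Operators with nonnegative kernels: existence, forms, composition -/

section IntegralOperators

variable {X Y Z : Type*} [MeasurableSpace X] [MeasurableSpace Y] [MeasurableSpace Z]
  {μ : Measure X} {ν : Measure Y} {ρ : Measure Z}

theorem lintegral_enorm_sq (f : Lp ℂ 2 μ) : ∫⁻ x, ‖f x‖ₑ ^ 2 ∂μ = ENNReal.ofReal ‖f‖ ^ 2 := by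
  have h := eLpNorm_eq_lintegral_rpow_enorm_toReal (p := 2) (μ := μ) (f := f) (by norm_num)
    (by norm_num)
  simp only [ENNReal.toReal_ofNat, ENNReal.rpow_two] at h
  rw [Lp.norm_def, ENNReal.ofReal_toReal (Lp.memLp f).eLpNorm_ne_top, h, ← ENNReal.rpow_two,
    ← ENNReal.rpow_mul]
  norm_num

theorem measurable_enorm_Lp (f : Lp ℂ 2 μ) : Measurable fun x => ‖f x‖ₑ :=
  (Lp.stronglyMeasurable f).enorm

/-- The function `y ↦ ∫ K(y, x) |f(x)| dx` is square integrable. -/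
theorem lintegral_kernel_sq_le {K : Y → X → ℝ} {C : ℝ≥0∞}
    (hb : KernelBound μ ν (fun y x => ENNReal.ofReal (K y x)) C) (f : Lp ℂ 2 μ) :
    ∫⁻ y, (∫⁻ x, ENNReal.ofReal (K y x) * ‖f x‖ₑ ∂μ) ^ 2 ∂ν ≤
      C ^ 2 * ENNReal.ofReal ‖f‖ ^ 2 := by
  rw [← lintegral_enorm_sq]
  exact hb _ (measurable_enorm_Lp f)

theorem enorm_kernel_mul {X Y : Type*} {K : Y → X → ℝ} (hK0 : ∀ y x, 0 ≤ K y x) (y : Y) (x : X) (z : ℂ) :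
    ‖(K y x : ℂ) * z‖ₑ = ENNReal.ofReal (K y x) * ‖z‖ₑ := by
  rw [enorm_mul]
  congr 1
  rw [← ofReal_norm, Complex.norm_real, Real.norm_of_nonneg (hK0 y x)]

theorem measurable_lintegral_kernel [SFinite μ] {K : Y → X → ℝ}
    (hK : Measurable fun z : Y × X => K z.1 z.2) (f : Lp ℂ 2 μ) :
    Measurable fun y => ∫⁻ x, ENNReal.ofReal (K y x) * ‖f x‖ₑ ∂μ :=
  Measurable.lintegral_prod_right' (f := fun z : Y × X => ENNReal.ofReal (K z.1 z.2) * ‖f z.2‖ₑ)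
    (hK.ennreal_ofReal.mul ((measurable_enorm_Lp f).comp measurable_snd))

theorem stronglyMeasurable_kernel_mul {K : Y → X → ℝ}
    (hK : Measurable fun z : Y × X => K z.1 z.2) (f : Lp ℂ 2 μ) :
    StronglyMeasurable fun z : Y × X => (K z.1 z.2 : ℂ) * f z.2 :=
  (Complex.measurable_ofReal.comp hK).stronglyMeasurable.mul
    ((Lp.stronglyMeasurable f).comp_measurable measurable_snd)

theorem ae_integrable_kernel_mul [SFinite μ] {K : Y → X → ℝ}
    (hK : Measurable fun z : Y × X => K z.1 z.2) (hK0 : ∀ y x, 0 ≤ K y x) {C : ℝ≥0∞}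
    (hC : C ≠ ∞) (hb : KernelBound μ ν (fun y x => ENNReal.ofReal (K y x)) C) (f : Lp ℂ 2 μ) :
    ∀ᵐ y ∂ν, Integrable (fun x => (K y x : ℂ) * f x) μ := by
  have h1 : ∫⁻ y, (∫⁻ x, ENNReal.ofReal (K y x) * ‖f x‖ₑ ∂μ) ^ 2 ∂ν ≠ ∞ :=
    ne_top_of_le_ne_top (by finiteness) (lintegral_kernel_sq_le hb f)
  filter_upwards [ae_lt_top ((measurable_lintegral_kernel hK f).pow_const 2) h1] with y hy
  refine ⟨((stronglyMeasurable_kernel_mul hK f).comp_measurable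
    measurable_prodMk_left).aestronglyMeasurable, ?_⟩
  rw [hasFiniteIntegral_iff_enorm]
  simp only [enorm_kernel_mul hK0]
  contrapose! hy
  rw [top_le_iff] at hy ⊢
  simp [hy]

theorem exists_isIntegralOperator [SFinite μ] {K : Y → X → ℝ}
    (hK : Measurable fun z : Y × X => K z.1 z.2) (hK0 : ∀ y x, 0 ≤ K y x) {C : ℝ≥0∞}
    (hC : C ≠ ∞) (hb : KernelBound μ ν (fun y x => ENNReal.ofReal (K y x)) C) :
    ∃ T : Lp ℂ 2 μ →L[ℂ] Lp ℂ 2 ν, IsIntegralOperator T K ∧ ‖T‖ ≤ C.toReal := by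
  set g : Lp ℂ 2 μ → Y → ℂ := fun f y => ∫ x, (K y x : ℂ) * f x ∂μ
  have hle : ∀ f : Lp ℂ 2 μ, eLpNorm (g f) 2 ν ≤ C * ENNReal.ofReal ‖f‖ := by
    intro f
    rw [eLpNorm_eq_lintegral_rpow_enorm_toReal (by norm_num) (by norm_num)]
    simp only [ENNReal.toReal_ofNat, ENNReal.rpow_two]
    have h1 : ∫⁻ y, ‖g f y‖ₑ ^ 2 ∂ν ≤ (C * ENNReal.ofReal ‖f‖) ^ 2 := by
      rw [mul_pow]
      refine le_trans (lintegral_mono fun y => ?_) (lintegral_kernel_sq_le hb f)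
      gcongr
      refine (enorm_integral_le_lintegral_enorm _).trans_eq ?_
      simp only [enorm_kernel_mul hK0]
    calc _ ≤ ((C * ENNReal.ofReal ‖f‖) ^ 2) ^ (1 / 2 : ℝ) := by gcongr
      _ = _ := by rw [← ENNReal.rpow_two, ← ENNReal.rpow_mul]; norm_num
  have hmem : ∀ f, MemLp (g f) 2 ν := fun f =>
    ⟨((stronglyMeasurable_kernel_mul hK f).integral_prod_right').aestronglyMeasurable,
      (hle f).trans_lt (by finiteness)⟩
  let L : Lp ℂ 2 μ →ₗ[ℂ] Lp ℂ 2 ν :=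
    { toFun := fun f => (hmem f).toLp (g f)
      map_add' := fun f f' => by
        rw [← MemLp.toLp_add]
        refine MemLp.toLp_congr _ _ ?_
        filter_upwards [ae_integrable_kernel_mul hK hK0 hC hb f,
          ae_integrable_kernel_mul hK hK0 hC hb f'] with y h1 h2
        simp only [g, Pi.add_apply]
        rw [← integral_add h1 h2]
        refine integral_congr_ae ?_
        filter_upwards [Lp.coeFn_add f f'] with x hx
        rw [hx, Pi.add_apply, mul_add]
      map_smul' := fun a f => by
        rw [RingHom.id_apply, ← MemLp.toLp_const_smul]
        refine MemLp.toLp_congr _ _ (Filter.Eventually.of_forall fun y => ?_)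
        simp only [g, Pi.smul_apply, smul_eq_mul]
        rw [← integral_const_mul]
        refine integral_congr_ae ?_
        filter_upwards [Lp.coeFn_smul a f] with x hx
        rw [hx, Pi.smul_apply, smul_eq_mul]
        ring }
  refine ⟨L.mkContinuous C.toReal fun f => ?_, fun f => ⟨ae_integrable_kernel_mul hK hK0 hC hb f,
    (hmem f).coeFn_toLp⟩, L.mkContinuous_norm_le ENNReal.toReal_nonneg _⟩
  have h1 : ‖L f‖ = (eLpNorm (g f) 2 ν).toReal := Lp.norm_toLp _ (hmem f)
  rw [h1]
  refine (ENNReal.toReal_mono (by finiteness) (hle f)).trans_eq ?_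
  rw [ENNReal.toReal_mul, ENNReal.toReal_ofReal (norm_nonneg f)]

theorem integrable_kernel_form [SFinite μ] [SFinite ν] {K : Y → X → ℝ}
    (hK : Measurable fun z : Y × X => K z.1 z.2) (hK0 : ∀ y x, 0 ≤ K y x) {C : ℝ≥0∞}
    (hC : C ≠ ∞) (hb : KernelBound μ ν (fun y x => ENNReal.ofReal (K y x)) C)
    (u : Lp ℂ 2 ν) (f : Lp ℂ 2 μ) :
    Integrable (fun z : Y × X => (K z.1 z.2 : ℂ) * f z.2 * conj (u z.1)) (ν.prod μ) := by
  have hm : StronglyMeasurable fun z : Y × X => (K z.1 z.2 : ℂ) * f z.2 * conj (u z.1) :=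
    (stronglyMeasurable_kernel_mul hK f).mul
      (RCLike.continuous_conj.comp_stronglyMeasurable
        ((Lp.stronglyMeasurable u).comp_measurable measurable_fst))
  refine ⟨hm.aestronglyMeasurable, ?_⟩
  rw [hasFiniteIntegral_iff_enorm, lintegral_prod _ hm.enorm.aemeasurable]
  have h1 : ∀ y, ∫⁻ x, ‖(K y x : ℂ) * f x * conj (u y)‖ₑ ∂μ =
      (∫⁻ x, ENNReal.ofReal (K y x) * ‖f x‖ₑ ∂μ) * ‖u y‖ₑ := by
    intro y
    rw [← lintegral_mul_const' _ _ (by finiteness)]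
    refine lintegral_congr fun x => ?_
    rw [enorm_mul, enorm_kernel_mul hK0]
    simp [← ofReal_norm]
  simp only [h1]
  have hF := measurable_lintegral_kernel hK f
  refine lt_of_le_of_lt (ENNReal.lintegral_mul_le_Lp_mul_Lq ν Real.HolderConjugate.two_two
    hF.aemeasurable (measurable_enorm_Lp u).aemeasurable) ?_
  simp only [ENNReal.rpow_two]
  rw [lintegral_enorm_sq]
  have h2 := (lintegral_kernel_sq_le hb f).trans_lt (by finiteness)
  finiteness

variable {K : Y → X → ℝ} {C : ℝ≥0∞} {T : Lp ℂ 2 μ →L[ℂ] Lp ℂ 2 ν}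

theorem IsIntegralOperator.inner_eq [SFinite μ] [SFinite ν] (hT : IsIntegralOperator T K)
    (hK : Measurable fun z : Y × X => K z.1 z.2) (hK0 : ∀ y x, 0 ≤ K y x)
    (hC : C ≠ ∞) (hb : KernelBound μ ν (fun y x => ENNReal.ofReal (K y x)) C)
    (u : Lp ℂ 2 ν) (f : Lp ℂ 2 μ) :
    ⟪u, T f⟫_ℂ = ∫ z : Y × X, (K z.1 z.2 : ℂ) * f z.2 * conj (u z.1) ∂(ν.prod μ) := by
  rw [integral_prod _ (integrable_kernel_form hK hK0 hC hb u f), L2.inner_def]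
  refine integral_congr_ae ?_
  filter_upwards [(hT f).2] with y hy
  rw [RCLike.inner_apply, hy, ← integral_mul_const]

theorem IsIntegralOperator.isSelfAdjoint [SFinite μ] {K : X → X → ℝ}
    {T : Lp ℂ 2 μ →L[ℂ] Lp ℂ 2 μ} (hT : IsIntegralOperator T K)
    (hK : Measurable fun z : X × X => K z.1 z.2) (hK0 : ∀ y x, 0 ≤ K y x)
    (hC : C ≠ ∞) (hb : KernelBound μ μ (fun y x => ENNReal.ofReal (K y x)) C)
    (hsymm : ∀ x y, K x y = K y x) : IsSelfAdjoint T := by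
  refine (show T.IsSymmetric from fun f g => ?_).isSelfAdjoint
  change ⟪T f, g⟫_ℂ = ⟪f, T g⟫_ℂ
  rw [← inner_conj_symm, hT.inner_eq hK hK0 hC hb, hT.inner_eq hK hK0 hC hb, ← integral_conj,
    ← integral_prod_swap]
  refine integral_congr_ae (Filter.Eventually.of_forall fun z => ?_)
  simp only [Prod.fst_swap, Prod.snd_swap, map_mul, Complex.conj_ofReal, Complex.conj_conj,
    hsymm z.1 z.2]
  ring

/-- Composition of integral operators with nonnegative kernels. -/
theorem IsIntegralOperator.comp_apply [SFinite μ] [SFinite ν] (hT : IsIntegralOperator T K)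
    (hK : Measurable fun z : Y × X => K z.1 z.2) (hK0 : ∀ y x, 0 ≤ K y x)
    (hC : C ≠ ∞) (hb : KernelBound μ ν (fun y x => ENNReal.ofReal (K y x)) C)
    {K' : Z → Y → ℝ} {T' : Lp ℂ 2 ν →L[ℂ] Lp ℂ 2 ρ} (hT' : IsIntegralOperator T' K')
    (hK' : Measurable fun z : Z × Y => K' z.1 z.2) (hK0' : ∀ y x, 0 ≤ K' y x) {C' : ℝ≥0∞}
    (hC' : C' ≠ ∞) (hb' : KernelBound ν ρ (fun y x => ENNReal.ofReal (K' y x)) C')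
    {K'' : Z → X → ℝ} {T'' : Lp ℂ 2 μ →L[ℂ] Lp ℂ 2 ρ} (hT'' : IsIntegralOperator T'' K'')
    (hcomp : ∀ z x, ∫ y, K' z y * K y x ∂ν = K'' z x) (f : Lp ℂ 2 μ) : T' (T f) = T'' f := by
  apply Lp.ext
  have hF := measurable_lintegral_kernel hK f
  -- Applying both kernel bounds in turn to |f| gives absolute convergence of the double integral
  -- for almost every `z`, which is what Fubini needs.
  have hfin : ∀ᵐ z ∂ρ, ∫⁻ y, ENNReal.ofReal (K' z y) *
      ∫⁻ x, ENNReal.ofReal (K y x) * ‖f x‖ₑ ∂μ ∂ν < ∞ := by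
    have h1 := (hb' _ hF).trans (mul_le_mul_right (lintegral_kernel_sq_le hb f) _)
    have h2 : Measurable fun z => ∫⁻ y, ENNReal.ofReal (K' z y) *
        ∫⁻ x, ENNReal.ofReal (K y x) * ‖f x‖ₑ ∂μ ∂ν :=
      Measurable.lintegral_prod_right' (f := fun z : Z × Y => ENNReal.ofReal (K' z.1 z.2) *
        ∫⁻ x, ENNReal.ofReal (K z.2 x) * ‖f x‖ₑ ∂μ)
        (hK'.ennreal_ofReal.mul (hF.comp measurable_snd))
    filter_upwards [ae_lt_top (h2.pow_const 2) (ne_top_of_le_ne_top (by finiteness) h1)] with z hz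
    contrapose! hz
    rw [top_le_iff] at hz ⊢
    simp [hz]
  filter_upwards [(hT' (T f)).2, (hT'' f).2, hfin] with z h1 h2 h3
  rw [h1, h2]
  have h4 : ∫ y, (K' z y : ℂ) * T f y ∂ν = ∫ y, ∫ x, (K' z y : ℂ) * ((K y x : ℂ) * f x) ∂μ ∂ν := by
    refine integral_congr_ae ?_
    filter_upwards [(hT f).2] with y hy
    rw [hy, integral_const_mul]
  rw [h4, integral_integral_swap]
  · refine integral_congr_ae (Filter.Eventually.of_forall fun x => ?_)
    simp only [← mul_assoc]
    rw [integral_mul_const, ← hcomp z x, ← integral_complex_ofReal]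
    simp only [Complex.ofReal_mul]
  · have hm : StronglyMeasurable fun w : Y × X => (K' z w.1 : ℂ) * ((K w.1 w.2 : ℂ) * f w.2) := by
      have hz : Measurable fun y => K' z y := hK'.comp measurable_prodMk_left
      exact (Complex.measurable_ofReal.comp (hz.comp measurable_fst)).stronglyMeasurable.mul
        (stronglyMeasurable_kernel_mul hK f)
    refine ⟨hm.aestronglyMeasurable, ?_⟩
    rw [hasFiniteIntegral_iff_enorm]
    change ∫⁻ w : Y × X, ‖(K' z w.1 : ℂ) * ((K w.1 w.2 : ℂ) * f w.2)‖ₑ ∂(ν.prod μ) < ∞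
    rw [lintegral_prod _ hm.enorm.aemeasurable]
    refine lt_of_le_of_lt (le_of_eq (lintegral_congr fun y => ?_)) h3
    rw [← lintegral_const_mul' _ _ (by finiteness)]
    refine lintegral_congr fun x => ?_
    rw [enorm_kernel_mul hK0', enorm_kernel_mul hK0]

/-- The norm of `T f` depends on `T` only through the kernel of T* T. Operators with different
target spaces can therefore be compared. -/
theorem IsIntegralOperator.norm_sq_eq [SFinite μ] [SFinite ν] (hT : IsIntegralOperator T K)
    (hK : Measurable fun z : Y × X => K z.1 z.2) (hK0 : ∀ y x, 0 ≤ K y x)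
    (hC : C ≠ ∞) (hb : KernelBound μ ν (fun y x => ENNReal.ofReal (K y x)) C) (f : Lp ℂ 2 μ) :
    ((‖T f‖ ^ 2 : ℝ) : ℂ) = ∫ z : X × X, ((∫ y, K y z.1 * K y z.2 ∂ν : ℝ) : ℂ) *
      (f z.1 * conj (f z.2)) ∂(μ.prod μ) := by
  have hf := Lp.stronglyMeasurable f
  have hm : StronglyMeasurable fun w : Y × X × X =>
      (K w.1 w.2.1 : ℂ) * f w.2.1 * ((K w.1 w.2.2 : ℂ) * conj (f w.2.2)) := by
    have h1 : StronglyMeasurable fun w : Y × X × X => (K w.1 w.2.1 : ℂ) * f w.2.1 :=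
      (stronglyMeasurable_kernel_mul hK f).comp_measurable
        (measurable_fst.prodMk (measurable_fst.comp measurable_snd))
    have h2 : StronglyMeasurable fun w : Y × X × X => conj ((K w.1 w.2.2 : ℂ) * f w.2.2) :=
      RCLike.continuous_conj.comp_stronglyMeasurable
        ((stronglyMeasurable_kernel_mul hK f).comp_measurable
          (measurable_fst.prodMk (measurable_snd.comp measurable_snd)))
    simp only [map_mul, Complex.conj_ofReal] at h2
    exact h1.mul h2
  have hint : Integrable (fun w : Y × X × X =>
      (K w.1 w.2.1 : ℂ) * f w.2.1 * ((K w.1 w.2.2 : ℂ) * conj (f w.2.2)))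
      (ν.prod (μ.prod μ)) := by
    refine ⟨hm.aestronglyMeasurable, ?_⟩
    rw [hasFiniteIntegral_iff_enorm, lintegral_prod _ hm.enorm.aemeasurable]
    refine lt_of_le_of_lt (le_of_eq (lintegral_congr fun y => ?_))
      ((lintegral_kernel_sq_le hb f).trans_lt (by finiteness))
    have hKy : Measurable fun x => K y x := hK.comp measurable_prodMk_left
    have hy : AEMeasurable (fun x => ENNReal.ofReal (K y x) * ‖f x‖ₑ) μ :=
      (hKy.ennreal_ofReal.mul hf.enorm).aemeasurable
    rw [sq, ← lintegral_prod_mul hy hy]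
    refine lintegral_congr fun z => ?_
    rw [enorm_mul, enorm_kernel_mul hK0, enorm_kernel_mul hK0]
    simp [← ofReal_norm]
  have h1 : ((‖T f‖ ^ 2 : ℝ) : ℂ) = ⟪T f, T f⟫_ℂ := by
    rw [inner_self_eq_norm_sq_to_K]; simp
  rw [h1, L2.inner_def]
  calc ∫ y, ⟪T f y, T f y⟫_ℂ ∂ν
      = ∫ y, ∫ z : X × X, (K y z.1 : ℂ) * f z.1 * ((K y z.2 : ℂ) * conj (f z.2)) ∂(μ.prod μ) ∂ν := by
        refine integral_congr_ae ?_
        filter_upwards [(hT f).2] with y hy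
        rw [RCLike.inner_apply, hy, ← integral_conj,
          integral_prod_mul (fun x => (K y x : ℂ) * f x) fun x => (K y x : ℂ) * conj (f x)]
        simp
    _ = ∫ z : X × X, ∫ y, (K y z.1 : ℂ) * f z.1 * ((K y z.2 : ℂ) * conj (f z.2)) ∂ν ∂(μ.prod μ) :=
        integral_integral_swap hint
    _ = _ := by
        refine integral_congr_ae (Filter.Eventually.of_forall fun z => ?_)
        simp only
        rw [← integral_complex_ofReal, ← integral_mul_const]
        refine integral_congr_ae (Filter.Eventually.of_forall fun y => ?_)
        simp only [Complex.ofReal_mul]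
        ring

/-- Operators with proportional kernels of `T* T` have proportional norms `‖T f‖²`. -/
theorem IsIntegralOperator.norm_sq_eq_mul [SFinite μ] [SFinite ν] [SFinite ρ]
    (hT : IsIntegralOperator T K)
    (hK : Measurable fun z : Y × X => K z.1 z.2) (hK0 : ∀ y x, 0 ≤ K y x)
    (hC : C ≠ ∞) (hb : KernelBound μ ν (fun y x => ENNReal.ofReal (K y x)) C)
    {K' : Z → X → ℝ} {T' : Lp ℂ 2 μ →L[ℂ] Lp ℂ 2 ρ} (hT' : IsIntegralOperator T' K')
    (hK' : Measurable fun z : Z × X => K' z.1 z.2) (hK0' : ∀ y x, 0 ≤ K' y x) {C' : ℝ≥0∞}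
    (hC' : C' ≠ ∞) (hb' : KernelBound μ ρ (fun y x => ENNReal.ofReal (K' y x)) C')
    {a : ℝ} (h : ∀ x x', ∫ y, K y x * K y x' ∂ν = a * ∫ z, K' z x * K' z x' ∂ρ) (f : Lp ℂ 2 μ) :
    ‖T f‖ ^ 2 = a * ‖T' f‖ ^ 2 := by
  rw [← Complex.ofReal_inj, Complex.ofReal_mul, hT.norm_sq_eq hK hK0 hC hb,
    hT'.norm_sq_eq hK' hK0' hC' hb', ← integral_const_mul]
  refine integral_congr_ae (Filter.Eventually.of_forall fun z => ?_)
  simp only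
  rw [h, Complex.ofReal_mul, mul_assoc]

/-- Hilbert–Schmidt operators are square summable on orthonormal families. -/
theorem IsIntegralOperator.sum_norm_sq_le (hT : IsIntegralOperator T K)
    (hmem : ∀ y, MemLp (fun x => (K y x : ℂ)) 2 μ) (hK0 : ∀ y x, 0 ≤ K y x) {D : ℝ} (hD0 : 0 ≤ D)
    (hD : ∫⁻ y, ∫⁻ x, ENNReal.ofReal (K y x) ^ 2 ∂μ ∂ν ≤ ENNReal.ofReal D)
    {ι : Type*} [Fintype ι] {v : ι → Lp ℂ 2 μ} (hv : Orthonormal ℂ v) :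
    ∑ i, ‖T (v i)‖ ^ 2 ≤ D := by
  set κ : Y → Lp ℂ 2 μ := fun y => (hmem y).toLp _
  have hκ : ∀ y, (fun x => κ y x) =ᵐ[μ] fun x => (K y x : ℂ) := fun y => (hmem y).coeFn_toLp
  have hκn : ∀ y, ENNReal.ofReal ‖κ y‖ ^ 2 = ∫⁻ x, ENNReal.ofReal (K y x) ^ 2 ∂μ := by
    intro y
    rw [← lintegral_enorm_sq]
    refine lintegral_congr_ae ?_
    filter_upwards [hκ y] with x hx
    rw [hx, ← ofReal_norm, Complex.norm_real, Real.norm_of_nonneg (hK0 y x)]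
  -- For fixed `y`, the values of the T v_i are coefficients of the slice `κ y`. Bessel's inequality
  -- bounds their squares, and integrating in `y` gives the Hilbert–Schmidt norm.
  have hTv : ∀ᵐ y ∂ν, ∀ i, T (v i) y = ⟪κ y, v i⟫_ℂ := by
    rw [ae_all_iff]
    intro i
    filter_upwards [(hT (v i)).2] with y hy
    rw [hy, L2.inner_def]
    refine integral_congr_ae ?_
    filter_upwards [hκ y] with x hx
    rw [RCLike.inner_apply, hx, Complex.conj_ofReal, mul_comm]
  refine (ENNReal.ofReal_le_ofReal_iff hD0).1 (le_trans ?_ hD)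
  rw [ENNReal.ofReal_sum_of_nonneg fun i _ => sq_nonneg _]
  simp only [ENNReal.ofReal_pow (norm_nonneg _), ← lintegral_enorm_sq]
  rw [← lintegral_finsetSum _ fun i _ => (measurable_enorm_Lp _).pow_const 2]
  refine lintegral_mono_ae ?_
  filter_upwards [hTv] with y hy
  rw [← hκn y, ← ENNReal.ofReal_pow (norm_nonneg _)]
  calc ∑ i, ‖T (v i) y‖ₑ ^ 2 = ENNReal.ofReal (∑ i, ‖⟪v i, κ y⟫_ℂ‖ ^ 2) := by
        rw [ENNReal.ofReal_sum_of_nonneg fun i _ => sq_nonneg _]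
        refine Finset.sum_congr rfl fun i _ => ?_
        rw [hy i, ← ofReal_norm, ← ENNReal.ofReal_pow (norm_nonneg _), norm_inner_symm]
    _ ≤ _ := ENNReal.ofReal_le_ofReal (hv.sum_inner_products_le (κ y))

/-! ### Integrals of kernels over a parameter -/

section Superposition

variable {k : Z → Y → X → ℝ}

theorem measurable_integral_kernel [SFinite ρ] (hk : Measurable fun z : Z × Y × X => k z.1 z.2.1 z.2.2) :
    Measurable fun z : Y × X => ∫ t, k t z.1 z.2 ∂ρ :=
  StronglyMeasurable.measurable (StronglyMeasurable.integral_prod_right'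
    (f := fun w : (Y × X) × Z => k w.2 w.1.1 w.1.2)
    (hk.comp measurable_swap).stronglyMeasurable)

theorem KernelBound.integral (hk0 : ∀ t y x, 0 ≤ k t y x)
    (hk : Measurable fun z : Z × Y × X => k z.1 z.2.1 z.2.2)
    (hb : KernelBound μ ν (fun y x => ∫⁻ t, ENNReal.ofReal (k t y x) ∂ρ) C) :
    KernelBound μ ν (fun y x => ENNReal.ofReal (∫ t, k t y x ∂ρ)) C := by
  refine hb.mono fun y x => ?_
  have hm : Measurable fun t => k t y x := by
    have := hk.comp (measurable_id.prodMk (measurable_const (a := (y, x))))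
    exact this
  rw [integral_eq_lintegral_of_nonneg_ae (Filter.Eventually.of_forall fun t => hk0 t y x)
    hm.aestronglyMeasurable]
  exact ENNReal.ofReal_toReal_le

/-- The sesquilinear form of a superposition of integral operators. -/
theorem IsIntegralOperator.inner_eq_integral [SFinite μ] [SFinite ν] [SFinite ρ]
    (hT : IsIntegralOperator T fun y x => ∫ t, k t y x ∂ρ) (hk0 : ∀ t y x, 0 ≤ k t y x)
    (hk : Measurable fun z : Z × Y × X => k z.1 z.2.1 z.2.2) (hC : C ≠ ∞)
    (hb : KernelBound μ ν (fun y x => ∫⁻ t, ENNReal.ofReal (k t y x) ∂ρ) C)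
    (u : Lp ℂ 2 ν) (f : Lp ℂ 2 μ) :
    ⟪u, T f⟫_ℂ =
      ∫ t, ∫ z : Y × X, (k t z.1 z.2 : ℂ) * f z.2 * conj (u z.1) ∂(ν.prod μ) ∂ρ := by
  rw [hT.inner_eq (measurable_integral_kernel hk)
    (fun y x => integral_nonneg fun t => hk0 t y x) hC (hb.integral hk0 hk)]
  have hm : StronglyMeasurable fun w : (Y × X) × Z =>
      (k w.2 w.1.1 w.1.2 : ℂ) * (f w.1.2 * conj (u w.1.1)) := by
    refine (Complex.measurable_ofReal.comp (hk.comp measurable_swap)).stronglyMeasurable.mul ?_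
    exact ((Lp.stronglyMeasurable f).comp_measurable (measurable_snd.comp measurable_fst)).mul
      (RCLike.continuous_conj.comp_stronglyMeasurable
        ((Lp.stronglyMeasurable u).comp_measurable (measurable_fst.comp measurable_fst)))
  have hmk : Measurable fun z : Y × X => ∫⁻ t, ENNReal.ofReal (k t z.1 z.2) ∂ρ :=
    Measurable.lintegral_prod_right'
      (f := fun w : (Y × X) × Z => ENNReal.ofReal (k w.2 w.1.1 w.1.2))
      (hk.comp measurable_swap).ennreal_ofReal
  have hmf := measurable_enorm_Lp f
  have hmF : Measurable fun y => ∫⁻ x, (∫⁻ t, ENNReal.ofReal (k t y x) ∂ρ) * ‖f x‖ₑ ∂μ :=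
    Measurable.lintegral_prod_right'
      (f := fun z : Y × X => (∫⁻ t, ENNReal.ofReal (k t z.1 z.2) ∂ρ) * ‖f z.2‖ₑ)
      (hmk.mul (hmf.comp measurable_snd))
  have hint : Integrable (fun w : (Y × X) × Z =>
      (k w.2 w.1.1 w.1.2 : ℂ) * (f w.1.2 * conj (u w.1.1))) ((ν.prod μ).prod ρ) := by
    refine ⟨hm.aestronglyMeasurable, ?_⟩
    rw [hasFiniteIntegral_iff_enorm, lintegral_prod _ hm.enorm.aemeasurable]
    have h1 : ∀ z : Y × X, ∫⁻ t, ‖(k t z.1 z.2 : ℂ) * (f z.2 * conj (u z.1))‖ₑ ∂ρ =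
        (∫⁻ t, ENNReal.ofReal (k t z.1 z.2) ∂ρ) * ‖f z.2‖ₑ * ‖u z.1‖ₑ := by
      intro z
      rw [mul_assoc, ← lintegral_mul_const' _ _ (by finiteness)]
      refine lintegral_congr fun t => ?_
      rw [enorm_kernel_mul (K := fun t z => k t z.1 z.2) (fun t z => hk0 t z.1 z.2) t z, enorm_mul]
      simp [← ofReal_norm]
    simp only [h1]
    have hm2 : Measurable fun z : Y × X =>
        (∫⁻ t, ENNReal.ofReal (k t z.1 z.2) ∂ρ) * ‖f z.2‖ₑ * ‖u z.1‖ₑ :=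
      (hmk.mul (hmf.comp measurable_snd)).mul ((measurable_enorm_Lp u).comp measurable_fst)
    rw [lintegral_prod _ hm2.aemeasurable]
    have h2 : ∀ y, ∫⁻ x, (∫⁻ t, ENNReal.ofReal (k t y x) ∂ρ) * ‖f x‖ₑ * ‖u y‖ₑ ∂μ =
        (∫⁻ x, (∫⁻ t, ENNReal.ofReal (k t y x) ∂ρ) * ‖f x‖ₑ ∂μ) * ‖u y‖ₑ := fun y =>
      lintegral_mul_const' _ _ (by finiteness)
    simp only [h2]
    refine lt_of_le_of_lt (ENNReal.lintegral_mul_le_Lp_mul_Lq ν Real.HolderConjugate.two_two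
      hmF.aemeasurable (measurable_enorm_Lp u).aemeasurable) ?_
    simp only [ENNReal.rpow_two]
    rw [lintegral_enorm_sq]
    have h3 := hb _ hmf
    rw [lintegral_enorm_sq] at h3
    have h4 := h3.trans_lt (by finiteness)
    finiteness
  calc ∫ z : Y × X, ((∫ t, k t z.1 z.2 ∂ρ : ℝ) : ℂ) * f z.2 * conj (u z.1) ∂(ν.prod μ)
      = ∫ z : Y × X, ∫ t, (k t z.1 z.2 : ℂ) * (f z.2 * conj (u z.1)) ∂ρ ∂(ν.prod μ) := by
        refine integral_congr_ae (Filter.Eventually.of_forall fun z => ?_)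
        simp only
        rw [integral_mul_const, integral_complex_ofReal, mul_assoc]
    _ = ∫ t, ∫ z : Y × X, (k t z.1 z.2 : ℂ) * (f z.2 * conj (u z.1)) ∂(ν.prod μ) ∂ρ :=
        integral_integral_swap hint
    _ = _ := by simp only [mul_assoc]

end Superposition

end IntegralOperators

end ZeroRange

namespace ZeroRange

open scoped ENNReal InnerProductSpace

/-! ### Calculus of Gaussian kernels on ℝ³ -/

section Gaussian

theorem integral_exp_neg_mul_sq_norm_add {σ : ℝ} (hσ : 0 < σ) (w : R3) :
    ∫ v : R3, Real.exp (-σ * ‖v‖ ^ 2 + 2 * ⟪w, v⟫_ℝ) =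
      (Real.pi / σ) ^ (3 / 2 : ℝ) * Real.exp (‖w‖ ^ 2 / σ) := by
  have h := GaussianFourier.integral_cexp_neg_mul_sq_norm_add (b := (σ : ℂ)) (by simpa using hσ) 2 w
  rw [← Complex.ofReal_inj, ← integral_complex_ofReal]
  push_cast
  rw [h, Complex.ofReal_cpow (by positivity)]
  have : (σ : ℂ) ≠ 0 := by exact_mod_cast hσ.ne'
  congr 1
  · simp
  · congr 1
    field_simp
    ring

/-- The Gaussian kernel `|κ|^(3/2) exp (-p |x|² - q |y|² + 2 r x · y)`. -/
def gaussKernel (κ p q r : ℝ) (x y : R3) : ℝ :=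
  |κ| ^ (3 / 2 : ℝ) * Real.exp (-p * ‖x‖ ^ 2 - q * ‖y‖ ^ 2 + 2 * r * ⟪x, y⟫_ℝ)

variable {κ p q r κ' p' q' r' : ℝ}

theorem gaussKernel_nonneg (κ p q r : ℝ) (x y : R3) : 0 ≤ gaussKernel κ p q r x y := by
  unfold gaussKernel; positivity

theorem gaussKernel_swap (x y : R3) : gaussKernel κ p q r y x = gaussKernel κ q p r x y := by
  unfold gaussKernel
  rw [real_inner_comm]
  congr 2
  ring

theorem gaussKernel_mul (x y : R3) :
    gaussKernel κ p q r x y * gaussKernel κ' p' q' r' x y =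
      gaussKernel (κ * κ') (p + p') (q + q') (r + r') x y := by
  unfold gaussKernel
  rw [abs_mul, Real.mul_rpow (abs_nonneg _) (abs_nonneg _), mul_mul_mul_comm, ← Real.exp_add]
  congr 2
  ring

theorem continuous_gaussKernel (κ p q r : ℝ) :
    Continuous fun z : R3 × R3 => gaussKernel κ p q r z.1 z.2 := by
  unfold gaussKernel; fun_prop

theorem measurable_gaussKernel (κ p q r : ℝ) :
    Measurable fun z : R3 × R3 => gaussKernel κ p q r z.1 z.2 :=
  (continuous_gaussKernel κ p q r).measurable

/-- Composition of Gaussian kernels. -/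
theorem integral_gaussKernel_mul (h : 0 < q + p') (x z : R3) :
    ∫ y, gaussKernel κ p q r x y * gaussKernel κ' p' q' r' y z =
      gaussKernel (κ * κ' * (Real.pi / (q + p'))) (p - r ^ 2 / (q + p')) (q' - r' ^ 2 / (q + p'))
        (r * r' / (q + p')) x z := by
  have h1 : ∀ y, gaussKernel κ p q r x y * gaussKernel κ' p' q' r' y z =
      |κ| ^ (3 / 2 : ℝ) * |κ'| ^ (3 / 2 : ℝ) * Real.exp (-p * ‖x‖ ^ 2 - q' * ‖z‖ ^ 2) *
        Real.exp (-(q + p') * ‖y‖ ^ 2 + 2 * ⟪r • x + r' • z, y⟫_ℝ) := by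
    intro y
    unfold gaussKernel
    rw [mul_mul_mul_comm, ← Real.exp_add, mul_assoc (_ * _), ← Real.exp_add]
    congr 2
    rw [inner_add_left, inner_smul_left, inner_smul_left, real_inner_comm y z]
    simp
    ring
  simp only [h1]
  rw [integral_const_mul, integral_exp_neg_mul_sq_norm_add h]
  unfold gaussKernel
  rw [abs_mul, abs_mul, abs_of_pos (show 0 < Real.pi / (q + p') by positivity),
    Real.mul_rpow (by positivity) (by positivity), Real.mul_rpow (by positivity) (by positivity)]
  have h2 : ‖r • x + r' • z‖ ^ 2 = r ^ 2 * ‖x‖ ^ 2 + 2 * (r * r' * ⟪x, z⟫_ℝ) + r' ^ 2 * ‖z‖ ^ 2 := by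
    rw [norm_add_sq_real, inner_smul_left, inner_smul_right, norm_smul, norm_smul, mul_pow, mul_pow]
    simp
    ring
  have h3 : Real.exp (-p * ‖x‖ ^ 2 - q' * ‖z‖ ^ 2) * Real.exp (‖r • x + r' • z‖ ^ 2 / (q + p')) =
      Real.exp (-(p - r ^ 2 / (q + p')) * ‖x‖ ^ 2 - (q' - r' ^ 2 / (q + p')) * ‖z‖ ^ 2 +
        2 * (r * r' / (q + p')) * ⟪x, z⟫_ℝ) := by
    rw [← Real.exp_add, h2]
    congr 1
    field_simp
    ring
  rw [← h3]
  ring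

theorem integral_gaussKernel (hq : 0 < q) (x : R3) :
    ∫ y, gaussKernel κ p q r x y =
      |κ * (Real.pi / q)| ^ (3 / 2 : ℝ) * Real.exp (-(p - r ^ 2 / q) * ‖x‖ ^ 2) := by
  have h := integral_gaussKernel_mul (κ := κ) (p := p) (q := q) (r := r) (κ' := 1) (p' := 0)
    (q' := 0) (r' := 0) (by simpa using hq) x 0
  simpa [gaussKernel] using h

theorem integrable_gaussKernel (hq : 0 < q) (x : R3) : Integrable (gaussKernel κ p q r x) := by
  by_cases hκ : κ = 0
  · have : gaussKernel κ p q r x = fun _ => 0 := by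
      funext y; simp [gaussKernel, hκ]
    rw [this]; exact integrable_zero _ _ _
  -- The Bochner integral of a nonintegrable function is 0, whereas the closed formula is positive.
  by_contra h
  have h1 := integral_gaussKernel (κ := κ) (p := p) (r := r) hq x
  rw [integral_undef h] at h1
  have : 0 < |κ * (Real.pi / q)| := by positivity
  exact absurd h1 (by positivity)

theorem lintegral_gaussKernel (hq : 0 < q) (x : R3) :
    ∫⁻ y, ENNReal.ofReal (gaussKernel κ p q r x y) = ENNReal.ofReal
      (|κ * (Real.pi / q)| ^ (3 / 2 : ℝ) * Real.exp (-(p - r ^ 2 / q) * ‖x‖ ^ 2)) := by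
  rw [← integral_gaussKernel hq, ofReal_integral_eq_lintegral_ofReal (integrable_gaussKernel hq x)
    (Filter.Eventually.of_forall fun y => gaussKernel_nonneg _ _ _ _ _ _)]

theorem lintegral_gaussKernel_le (hq : 0 < q) (hr : r ^ 2 ≤ p * q) (x : R3) :
    ∫⁻ y, ENNReal.ofReal (gaussKernel κ p q r x y) ≤
      ENNReal.ofReal (|κ * (Real.pi / q)| ^ (3 / 2 : ℝ)) := by
  rw [lintegral_gaussKernel hq]
  refine ENNReal.ofReal_le_ofReal (mul_le_of_le_one_right (by positivity) ?_)
  rw [Real.exp_le_one_iff]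
  have : r ^ 2 / q ≤ p := by rwa [div_le_iff₀ hq]
  nlinarith [sq_nonneg ‖x‖]

/-- Schur's test: the condition on `r` makes the Gaussian left after either integration at most 1. A
common lower bound `m` gives one constant for rows and columns. -/
theorem kernelBound_gaussKernel {m : ℝ} (hm : 0 < m) (hp : m ≤ p) (hq : m ≤ q)
    (hr : r ^ 2 ≤ p * q) :
    KernelBound volume volume (fun x y => ENNReal.ofReal (gaussKernel κ p q r x y))
      (ENNReal.ofReal (|κ * (Real.pi / m)| ^ (3 / 2 : ℝ))) := by
  have hmono : ∀ s, m ≤ s → |κ * (Real.pi / s)| ^ (3 / 2 : ℝ) ≤ |κ * (Real.pi / m)| ^ (3 / 2 : ℝ) := by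
    intro s hs
    rw [abs_mul, abs_mul, abs_of_pos (show 0 < Real.pi / m by positivity),
      abs_of_pos (div_pos Real.pi_pos (hm.trans_le hs))]
    have := hm.trans_le hs
    gcongr
  refine kernelBound_of_schur (measurable_gaussKernel κ p q r).ennreal_ofReal (fun x => ?_)
    fun y => ?_
  · exact (lintegral_gaussKernel_le (hm.trans_le hq) hr x).trans
      (ENNReal.ofReal_le_ofReal (hmono q hq))
  · simp only [gaussKernel_swap y]
    exact (lintegral_gaussKernel_le (hm.trans_le hp) (by linarith) y).trans
      (ENNReal.ofReal_le_ofReal (hmono p hp))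

end Gaussian

/-- The operator with kernel `K`, or zero if there is none. -/
def integralOperator {X Y : Type*} [MeasurableSpace X] [MeasurableSpace Y]
    (μ : Measure X) (ν : Measure Y) (K : Y → X → ℝ) : Lp ℂ 2 μ →L[ℂ] Lp ℂ 2 ν :=
  open Classical in if h : ∃ T : Lp ℂ 2 μ →L[ℂ] Lp ℂ 2 ν, IsIntegralOperator T K then h.choose else 0

theorem isIntegralOperator_integralOperator {X Y : Type*} [MeasurableSpace X] [MeasurableSpace Y]
    {μ : Measure X} {ν : Measure Y} [SFinite μ] {K : Y → X → ℝ}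
    (hK : Measurable fun z : Y × X => K z.1 z.2) (hK0 : ∀ y x, 0 ≤ K y x) {C : ℝ≥0∞}
    (hC : C ≠ ∞) (hb : KernelBound μ ν (fun y x => ENNReal.ofReal (K y x)) C) :
    IsIntegralOperator (integralOperator μ ν K) K ∧ ‖integralOperator μ ν K‖ ≤ C.toReal := by
  obtain ⟨T, hT, hTn⟩ := exists_isIntegralOperator hK hK0 hC hb
  have h : ∃ T : Lp ℂ 2 μ →L[ℂ] Lp ℂ 2 ν, IsIntegralOperator T K := ⟨T, hT⟩
  have h1 : IsIntegralOperator (integralOperator μ ν K) K := by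
    rw [integralOperator, dif_pos h]; exact h.choose_spec
  exact ⟨h1, (h1.unique hT) ▸ hTn⟩

/-! ### Domination between Gaussian operators with the same confinement -/

section Comparison

variable {Y Y' : Type*} [MeasurableSpace Y] [MeasurableSpace Y'] {ν : Measure Y} {ν' : Measure Y'}
  [SFinite ν] [SFinite ν']

/-- Comparison of two operators `T`, `T'` such that the kernels of `T* T` and `T'* T'` are Gaussians
`exp (-a |x|²) exp (-b |x - x'|²) exp (-a |x'|²)` with the same `a`. -/
theorem norm_sq_le_of_gaussKernel {a b b' κ κ' : ℝ} (ha : 0 ≤ a) (hb : 0 < b) (hbb' : b < b')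
    (hκ' : 0 < κ') (hκ : 0 < κ) {K : Y → R3 → ℝ} {T : L2R3 →L[ℂ] Lp ℂ 2 ν}
    (hT : IsIntegralOperator T K)
    (hK : Measurable fun z : Y × R3 => K z.1 z.2) (hK0 : ∀ y x, 0 ≤ K y x) {C : ℝ≥0∞}
    (hC : C ≠ ∞) (hKb : KernelBound volume ν (fun y x => ENNReal.ofReal (K y x)) C)
    (hL : ∀ x x', ∫ y, K y x * K y x' ∂ν = gaussKernel κ (a + b) (a + b) b x x')
    {K' : Y' → R3 → ℝ} {T' : L2R3 →L[ℂ] Lp ℂ 2 ν'}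
    (hT' : IsIntegralOperator T' K')
    (hK' : Measurable fun z : Y' × R3 => K' z.1 z.2) (hK0' : ∀ y x, 0 ≤ K' y x) {C' : ℝ≥0∞}
    (hC' : C' ≠ ∞) (hKb' : KernelBound volume ν' (fun y x => ENNReal.ofReal (K' y x)) C')
    (hL' : ∀ x x', ∫ y, K' y x * K' y x' ∂ν' = gaussKernel κ' (a + b') (a + b') b' x x')
    (f : L2R3) :
    ‖T f‖ ^ 2 ≤ (κ * b' / (κ' * b)) ^ (3 / 2 : ℝ) * ‖T' f‖ ^ 2 := by
  have hb' : 0 < b' := hb.trans hbb'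
  -- Variances add under convolution, so `s` solves 1/s + 1/(2b') = 1/(2b). Convolution with
  -- exp(-s|z|²), normalised by the prefactor (s+2b')/π, sends the operator for `b'` to the operator
  -- for `b`, at the cost of the norm (1 + 2b'/s)^{3/2} = (b'/b)^{3/2}.
  set s : ℝ := 2 * b * b' / (b' - b)
  have hs : 0 < s := by have : 0 < b' - b := by linarith
                        positivity
  -- the operators with kernel `exp (-2 b |z - x|²) exp (-a |x|²)`
  have hR : ∀ β, 0 < β → KernelBound volume volume
      (fun x y => ENNReal.ofReal (gaussKernel 1 (2 * β) (2 * β + a) (2 * β) x y)) _ := fun β hβ =>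
    kernelBound_gaussKernel (m := 2 * β) (by positivity) le_rfl (by linarith)
      (by nlinarith [mul_nonneg hβ.le ha])
  have hRm := fun β : ℝ => measurable_gaussKernel 1 (2 * β) (2 * β + a) (2 * β)
  have hRop := fun (β : ℝ) (hβ : 0 < β) => (isIntegralOperator_integralOperator
    (hRm β) (gaussKernel_nonneg _ _ _ _) ENNReal.ofReal_ne_top (hR β hβ)).1
  have hRR : ∀ β, 0 < β → ∀ x x', ∫ z, gaussKernel 1 (2 * β) (2 * β + a) (2 * β) z x *
      gaussKernel 1 (2 * β) (2 * β + a) (2 * β) z x' =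
        gaussKernel (Real.pi / (4 * β)) (a + β) (a + β) β x x' := by
    intro β hβ x x'
    simp only [gaussKernel_swap x]
    rw [integral_gaussKernel_mul (by positivity)]
    congr 1 <;> field_simp <;> ring
  have hN := kernelBound_gaussKernel (κ := (s + 2 * b') / Real.pi) (p := s) (q := s) (r := s) hs
    le_rfl le_rfl (by rw [sq])
  have hNop := isIntegralOperator_integralOperator (measurable_gaussKernel _ _ _ _)
    (gaussKernel_nonneg _ _ _ _) ENNReal.ofReal_ne_top hN
  have hcomp := (hRop b' hb').comp_apply (hRm b') (gaussKernel_nonneg _ _ _ _) ENNReal.ofReal_ne_top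
    (hR b' hb') hNop.1 (measurable_gaussKernel _ _ _ _) (gaussKernel_nonneg _ _ _ _)
    ENNReal.ofReal_ne_top hN (hRop b hb) (fun z x => by
      rw [integral_gaussKernel_mul (by positivity)]
      have h0 : b' - b ≠ 0 := by linarith
      have h1 : s + 2 * b' = 2 * b' ^ 2 / (b' - b) := by simp only [s]; field_simp; ring
      have h2 : s + 2 * b' ≠ 0 := by positivity
      have h3 : (s + 2 * b') / Real.pi * 1 * (Real.pi / (s + 2 * b')) = 1 := by field_simp
      rw [h3, h1]
      congr 1 <;> (try simp only [s]) <;> field_simp <;> ring) f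
  have hNn : ‖integralOperator volume volume (gaussKernel ((s + 2 * b') / Real.pi) s s s)‖ ≤
      (b' / b) ^ (3 / 2 : ℝ) := by
    refine hNop.2.trans_eq ?_
    rw [ENNReal.toReal_ofReal (by positivity), abs_of_pos (by positivity)]
    congr 1
    have h0 : b' - b ≠ 0 := by linarith
    simp only [s]
    field_simp
    ring
  have hscale : ∀ {c d e : ℝ}, 0 < c → 0 < d → ∀ x x' : R3, gaussKernel c (a + e) (a + e) e x x' =
      (c / d) ^ (3 / 2 : ℝ) * gaussKernel d (a + e) (a + e) e x x' := by
    intro c d e hc hd x x'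
    unfold gaussKernel
    rw [abs_of_pos hc, abs_of_pos hd, Real.div_rpow hc.le hd.le, ← mul_assoc,
      div_mul_cancel₀ _ (by positivity)]
  -- `T` and the model operator have kernels of T* T that differ by a constant only; likewise for
  -- `T'`. The comparison is thus reduced to the models.
  have h1 := hT.norm_sq_eq_mul hK hK0 hC hKb (hRop b hb) (hRm b) (gaussKernel_nonneg _ _ _ _)
    ENNReal.ofReal_ne_top (hR b hb) (a := (κ / (Real.pi / (4 * b))) ^ (3 / 2 : ℝ))
    (fun x x' => by rw [hL, hRR b hb, ← hscale hκ (by positivity)]) f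
  have h2 := (hRop b' hb').norm_sq_eq_mul (hRm b') (gaussKernel_nonneg _ _ _ _)
    ENNReal.ofReal_ne_top (hR b' hb') hT' hK' hK0' hC' hKb'
    (a := (Real.pi / (4 * b') / κ') ^ (3 / 2 : ℝ))
    (fun x x' => by rw [hL', hRR b' hb', ← hscale (by positivity) hκ']) f
  have h3 : ‖integralOperator volume volume (gaussKernel 1 (2 * b) (2 * b + a) (2 * b)) f‖ ≤
      (b' / b) ^ (3 / 2 : ℝ) *
        ‖integralOperator volume volume (gaussKernel 1 (2 * b') (2 * b' + a) (2 * b')) f‖ := by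
    rw [← hcomp]
    exact ContinuousLinearMap.le_of_opNorm_le _ hNn _
  rw [h1]
  calc _ ≤ (κ / (Real.pi / (4 * b))) ^ (3 / 2 : ℝ) * ((b' / b) ^ (3 / 2 : ℝ) *
        ‖integralOperator volume volume (gaussKernel 1 (2 * b') (2 * b' + a) (2 * b')) f‖) ^ 2 := by
        gcongr
    _ = (κ / (Real.pi / (4 * b))) ^ (3 / 2 : ℝ) * ((b' / b) ^ (3 / 2 : ℝ) * (b' / b) ^ (3 / 2 : ℝ) *
          ((Real.pi / (4 * b') / κ') ^ (3 / 2 : ℝ) * ‖T' f‖ ^ 2)) := by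
        rw [mul_pow, h2, sq ((b' / b) ^ (3 / 2 : ℝ))]
    _ = (κ / (Real.pi / (4 * b)) * (b' / b * (b' / b)) * (Real.pi / (4 * b') / κ')) ^ (3 / 2 : ℝ) *
          ‖T' f‖ ^ 2 := by
        rw [Real.mul_rpow (by positivity) (by positivity),
          Real.mul_rpow (by positivity) (by positivity),
          Real.mul_rpow (by positivity) (by positivity)]
        ring
    _ = _ := by
        congr 2
        field_simp

end Comparison

end ZeroRange

namespace ZeroRange

open scoped ENNReal InnerProductSpace ComplexConjugate

/-! ### Laplace transforms of families of integral operators -/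

section Laplace

variable {X Y : Type*} [MeasurableSpace X] [MeasurableSpace Y] {μ : Measure X} {ν : Measure Y}
  [SFinite μ] [SFinite ν]

/-- The Laplace transform of a family of integral operators with nonnegative kernels. -/
theorem exists_laplace_isIntegralOperator {k : ℝ → Y → X → ℝ}
    (hk : Measurable fun z : ℝ × Y × X => k z.1 z.2.1 z.2.2) (hk0 : ∀ t y x, 0 ≤ k t y x)
    {T : ℝ → Lp ℂ 2 μ →L[ℂ] Lp ℂ 2 ν} (hT : ∀ t, 0 < t → IsIntegralOperator (T t) (k t))
    {c : ℝ → ℝ} (hc : Measurable c) (hc0 : ∀ t, 0 < c t)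
    (hb : ∀ t, 0 < t →
      KernelBound μ ν (fun y x => ENNReal.ofReal (k t y x)) (ENNReal.ofReal (c t)))
    {lam : ℝ} (hint : IntegrableOn (fun t => Real.exp (-lam * t) * c t) (Set.Ioi 0)) :
    ∃ G : Lp ℂ 2 μ →L[ℂ] Lp ℂ 2 ν,
      IsIntegralOperator G (fun y x => ∫ t in Set.Ioi (0 : ℝ), Real.exp (-lam * t) * k t y x) ∧
      ∀ u f, ⟪u, G f⟫_ℂ = ∫ t in Set.Ioi (0 : ℝ), (Real.exp (-lam * t) : ℂ) * ⟪u, T t f⟫_ℂ := by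
  have hw0 : ∀ t y x, 0 ≤ Real.exp (-lam * t) * k t y x := fun t y x =>
    mul_nonneg (Real.exp_pos _).le (hk0 t y x)
  have hexp : Measurable fun t : ℝ => Real.exp (-lam * t) := by fun_prop
  have hw : Measurable fun z : ℝ × Y × X => Real.exp (-lam * z.1) * k z.1 z.2.1 z.2.2 :=
    (hexp.comp measurable_fst).mul hk
  set C : ℝ≥0∞ := ∫⁻ t in Set.Ioi 0, ENNReal.ofReal (Real.exp (-lam * t) * c t)
  have hC : C ≠ ∞ := hint.lintegral_lt_top.ne
  have hB : KernelBound μ ν (fun y x => ∫⁻ t in Set.Ioi (0 : ℝ),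
      ENNReal.ofReal (Real.exp (-lam * t) * k t y x)) C := by
    refine kernelBound_lintegral hw.ennreal_ofReal (hexp.mul hc).ennreal_ofReal (fun t => ?_)
      (fun t => ENNReal.ofReal_ne_top) ?_
    · exact (ENNReal.ofReal_pos.2 (mul_pos (Real.exp_pos _) (hc0 t))).ne'
    · filter_upwards [ae_restrict_mem measurableSet_Ioi] with t ht
      have := (hb t ht).const_mul (ENNReal.ofReal (Real.exp (-lam * t))) ENNReal.ofReal_ne_top
      simpa only [← ENNReal.ofReal_mul (Real.exp_pos _).le] using this
  obtain ⟨G, hG, -⟩ := exists_isIntegralOperator (measurable_integral_kernel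
    (k := fun t y x => Real.exp (-lam * t) * k t y x) (ρ := volume.restrict (Set.Ioi 0)) hw)
    (fun y x => integral_nonneg fun t => hw0 t y x) hC (hB.integral hw0 hw)
  refine ⟨G, hG, fun u f => ?_⟩
  rw [hG.inner_eq_integral hw0 hw hC hB]
  refine setIntegral_congr_fun measurableSet_Ioi fun t ht => ?_
  have hkt : Measurable fun z : Y × X => k t z.1 z.2 := by
    have := hk.comp ((measurable_const (a := t)).prodMk measurable_id)
    exact this
  rw [(hT t ht).inner_eq hkt (hk0 t) ENNReal.ofReal_ne_top (hb t ht), ← integral_const_mul]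
  refine integral_congr_ae (Filter.Eventually.of_forall fun z => ?_)
  simp only [Complex.ofReal_mul]
  ring

end Laplace

/-! ### Heat and Mehler kernels, their semigroup laws and Schur bounds -/

section Kernels

/-- The heat kernel of `-Δ / 2`. -/
def heatKernel (t : ℝ) : R3 → R3 → ℝ :=
  gaussKernel (1 / (2 * Real.pi * t)) (1 / (2 * t)) (1 / (2 * t)) (1 / (2 * t))

/-- The Mehler kernel of the harmonic oscillator of frequency `Ω` with ground state energy `0` at
the time `t` with `ν = exp (-Ω t)`. -/
def mehlerKernel (Ω ν : ℝ) : R3 → R3 → ℝ :=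
  gaussKernel (Ω / (Real.pi * (1 - ν ^ 2))) (Ω * (1 + ν ^ 2) / (2 * (1 - ν ^ 2)))
    (Ω * (1 + ν ^ 2) / (2 * (1 - ν ^ 2))) (Ω * ν / (1 - ν ^ 2))

/-- The kernel of the semigroup `exp (-t H₀)`. -/
def evolutionKernel (ω t : ℝ) (X X' : R3 × R3) : ℝ :=
  heatKernel t X.1 X'.1 * mehlerKernel ω (Real.exp (-ω * t)) X.2 X'.2

/-- The kernel of `exp (-t H₀)` with the second point on the plane `x = y`. -/
def traceKernel (ω t : ℝ) (X : R3 × R3) (z : R3) : ℝ :=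
  evolutionKernel ω t X (z, z)

theorem measurable_gaussKernel_comp {α : Type*} [MeasurableSpace α] {κ p q r : α → ℝ} {x y : α → R3}
    (hκ : Measurable κ) (hp : Measurable p) (hq : Measurable q) (hr : Measurable r)
    (hx : Measurable x) (hy : Measurable y) :
    Measurable fun a => gaussKernel (κ a) (p a) (q a) (r a) (x a) (y a) := by
  unfold gaussKernel
  refine Measurable.mul (hκ.abs.pow_const _) (Real.measurable_exp.comp ?_)
  exact ((hp.neg.mul (hx.norm.pow_const 2)).sub (hq.mul (hy.norm.pow_const 2))).add
    ((measurable_const.mul hr).mul (hx.inner hy))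

theorem measurable_evolutionKernel (ω : ℝ) :
    Measurable fun z : ℝ × (R3 × R3) × (R3 × R3) => evolutionKernel ω z.1 z.2.1 z.2.2 := by
  unfold evolutionKernel heatKernel mehlerKernel
  refine Measurable.mul ?_ ?_ <;> refine measurable_gaussKernel_comp ?_ ?_ ?_ ?_ ?_ ?_ <;> fun_prop

theorem measurable_traceKernel (ω : ℝ) :
    Measurable fun z : ℝ × (R3 × R3) × R3 => traceKernel ω z.1 z.2.1 z.2.2 := by
  have h : Measurable fun z : ℝ × (R3 × R3) × R3 => (z.1, z.2.1, (z.2.2, z.2.2)) := by fun_prop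
  have h' := (measurable_evolutionKernel ω).comp h
  simp only [Function.comp_def] at h'
  exact h'

theorem measurable_evolutionKernel_right (ω t : ℝ) :
    Measurable fun z : (R3 × R3) × (R3 × R3) => evolutionKernel ω t z.1 z.2 := by
  have := (measurable_evolutionKernel ω).comp ((measurable_const (a := t)).prodMk measurable_id)
  exact this

theorem measurable_traceKernel_right (ω t : ℝ) :
    Measurable fun z : (R3 × R3) × R3 => traceKernel ω t z.1 z.2 := by
  have := (measurable_traceKernel ω).comp ((measurable_const (a := t)).prodMk measurable_id)
  exact this

theorem heatKernel_nonneg (t : ℝ) (x y : R3) : 0 ≤ heatKernel t x y := gaussKernel_nonneg _ _ _ _ _ _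

theorem mehlerKernel_nonneg (Ω ν : ℝ) (x y : R3) : 0 ≤ mehlerKernel Ω ν x y :=
  gaussKernel_nonneg _ _ _ _ _ _

theorem evolutionKernel_nonneg (ω t : ℝ) (X X' : R3 × R3) : 0 ≤ evolutionKernel ω t X X' :=
  mul_nonneg (heatKernel_nonneg _ _ _) (mehlerKernel_nonneg _ _ _ _)

theorem traceKernel_nonneg (ω t : ℝ) (X : R3 × R3) (z : R3) : 0 ≤ traceKernel ω t X z :=
  evolutionKernel_nonneg _ _ _ _

theorem heatKernel_swap (t : ℝ) (x y : R3) : heatKernel t y x = heatKernel t x y :=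
  gaussKernel_swap _ _

theorem mehlerKernel_swap (Ω ν : ℝ) (x y : R3) : mehlerKernel Ω ν y x = mehlerKernel Ω ν x y :=
  gaussKernel_swap _ _

theorem integral_heatKernel_mul {s t : ℝ} (hs : 0 < s) (ht : 0 < t) (x z : R3) :
    ∫ y, heatKernel s x y * heatKernel t y z = heatKernel (s + t) x z := by
  unfold heatKernel
  rw [integral_gaussKernel_mul (by positivity)]
  congr 1 <;> field_simp <;> ring

theorem integral_mehlerKernel_mul {Ω ν ν' : ℝ} (hΩ : 0 < Ω) (hν : 0 < ν) (hν1 : ν < 1)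
    (hν' : 0 < ν') (hν1' : ν' < 1) (x z : R3) :
    ∫ y, mehlerKernel Ω ν x y * mehlerKernel Ω ν' y z = mehlerKernel Ω (ν * ν') x z := by
  have h1 : 0 < 1 - ν ^ 2 := by nlinarith
  have h2 : 0 < 1 - ν' ^ 2 := by nlinarith
  have h3 : 0 < 1 - (ν * ν') ^ 2 := by
    have : ν * ν' < 1 := by nlinarith
    have : 0 < ν * ν' := by positivity
    nlinarith
  have hσ : Ω * (1 + ν ^ 2) / (2 * (1 - ν ^ 2)) + Ω * (1 + ν' ^ 2) / (2 * (1 - ν' ^ 2)) =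
      Ω * (1 - (ν * ν') ^ 2) / ((1 - ν ^ 2) * (1 - ν' ^ 2)) := by
    field_simp
    ring
  unfold mehlerKernel
  rw [integral_gaussKernel_mul (by positivity), hσ]
  rw [mul_pow] at h3
  have h4 : 1 - ν' ^ 2 * ν ^ 2 ≠ 0 := by rw [mul_comm]; exact h3.ne'
  simp only [mul_pow]
  congr 1 <;> field_simp <;> ring

theorem lintegral_heatKernel {t : ℝ} (ht : 0 < t) (x : R3) :
    ∫⁻ y, ENNReal.ofReal (heatKernel t x y) ≤ 1 := by
  refine (lintegral_gaussKernel_le (by positivity) (by rw [sq]) x).trans_eq ?_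
  have : 1 / (2 * Real.pi * t) * (Real.pi / (1 / (2 * t))) = 1 := by field_simp
  rw [this]
  simp

variable {Ω ν : ℝ}

theorem mehler_sq_le (hΩ : 0 < Ω) (hν : 0 < ν) (hν1 : ν < 1) :
    (Ω * ν / (1 - ν ^ 2)) ^ 2 ≤
      Ω * (1 + ν ^ 2) / (2 * (1 - ν ^ 2)) * (Ω * (1 + ν ^ 2) / (2 * (1 - ν ^ 2))) := by
  have h1 : 0 < 1 - ν ^ 2 := by nlinarith
  rw [← sq]
  refine pow_le_pow_left₀ (by positivity) ?_ 2
  rw [div_le_div_iff₀ h1 (by positivity)]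
  have : Ω * ν * 2 ≤ Ω * (1 + ν ^ 2) := by nlinarith [mul_nonneg hΩ.le (sq_nonneg (1 - ν))]
  nlinarith

/-- The expression in absolute value is 2/(1+ν²). A crude constant is enough, as long as it is
uniform in `ν`. -/
theorem mehler_const_le (hΩ : 0 < Ω) (hν : 0 < ν) (hν1 : ν < 1) :
    |Ω / (Real.pi * (1 - ν ^ 2)) * (Real.pi / (Ω * (1 + ν ^ 2) / (2 * (1 - ν ^ 2))))| ^ (3 / 2 : ℝ)
      ≤ 4 := by
  have h1 : 0 < 1 - ν ^ 2 := by nlinarith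
  have h2 : Ω / (Real.pi * (1 - ν ^ 2)) * (Real.pi / (Ω * (1 + ν ^ 2) / (2 * (1 - ν ^ 2)))) =
      2 / (1 + ν ^ 2) := by field_simp
  rw [h2, abs_of_pos (by positivity)]
  calc (2 / (1 + ν ^ 2)) ^ (3 / 2 : ℝ) ≤ 2 ^ (3 / 2 : ℝ) := by
        gcongr
        exact div_le_self (by norm_num) (by nlinarith)
    _ ≤ 2 ^ (2 : ℝ) := Real.rpow_le_rpow_of_exponent_le (by norm_num) (by norm_num)
    _ = 4 := by norm_num

theorem lintegral_mehlerKernel (hΩ : 0 < Ω) (hν : 0 < ν) (hν1 : ν < 1) (x : R3) :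
    ∫⁻ y, ENNReal.ofReal (mehlerKernel Ω ν x y) ≤ ENNReal.ofReal 4 := by
  have h1 : 0 < 1 - ν ^ 2 := by nlinarith
  exact (lintegral_gaussKernel_le (by positivity) (mehler_sq_le hΩ hν hν1) x).trans
    (ENNReal.ofReal_le_ofReal (mehler_const_le hΩ hν hν1))

theorem kernelBound_mehlerKernel (hΩ : 0 < Ω) (hν : 0 < ν) (hν1 : ν < 1) :
    KernelBound volume volume (fun x y => ENNReal.ofReal (mehlerKernel Ω ν x y))
      (ENNReal.ofReal 4) := by
  have h1 : 0 < 1 - ν ^ 2 := by nlinarith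
  exact (kernelBound_gaussKernel (by positivity) le_rfl le_rfl
    (mehler_sq_le hΩ hν hν1)).mono_right (ENNReal.ofReal_le_ofReal (mehler_const_le hΩ hν hν1))

theorem lintegral_evolutionKernel {ω t : ℝ} (hω : 0 < ω) (ht : 0 < t) (X : R3 × R3) :
    ∫⁻ X', ENNReal.ofReal (evolutionKernel ω t X X') ≤ ENNReal.ofReal 4 := by
  have hm1 : AEMeasurable (fun x => ENNReal.ofReal (heatKernel t X.1 x)) volume :=
    ((measurable_gaussKernel _ _ _ _).comp measurable_prodMk_left).ennreal_ofReal.aemeasurable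
  have hm2 : AEMeasurable
      (fun y => ENNReal.ofReal (mehlerKernel ω (Real.exp (-ω * t)) X.2 y)) volume :=
    ((measurable_gaussKernel _ _ _ _).comp measurable_prodMk_left).ennreal_ofReal.aemeasurable
  simp only [evolutionKernel, ENNReal.ofReal_mul (heatKernel_nonneg _ _ _)]
  rw [Measure.volume_eq_prod, lintegral_prod_mul hm1 hm2]
  calc _ ≤ 1 * ENNReal.ofReal 4 := by
        gcongr
        · exact lintegral_heatKernel ht _
        · exact lintegral_mehlerKernel hω (Real.exp_pos _) (by
            rw [Real.exp_lt_one_iff]; nlinarith) _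
    _ = _ := one_mul _

theorem kernelBound_evolutionKernel {ω t : ℝ} (hω : 0 < ω) (ht : 0 < t) :
    KernelBound volume volume (fun X X' => ENNReal.ofReal (evolutionKernel ω t X X'))
      (ENNReal.ofReal 4) := by
  refine kernelBound_of_schur (measurable_evolutionKernel_right ω t).ennreal_ofReal
    (lintegral_evolutionKernel hω ht) fun X' => ?_
  have : ∀ X, evolutionKernel ω t X X' = evolutionKernel ω t X' X := fun X => by
    unfold evolutionKernel
    rw [heatKernel_swap, mehlerKernel_swap]
  simp only [this]
  exact lintegral_evolutionKernel hω ht X'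

theorem integral_evolutionKernel_mul {ω s t : ℝ} (hω : 0 < ω) (hs : 0 < s) (ht : 0 < t)
    (X Z : R3 × R3) :
    ∫ Y, evolutionKernel ω s X Y * evolutionKernel ω t Y Z = evolutionKernel ω (s + t) X Z := by
  simp only [evolutionKernel, mul_mul_mul_comm (heatKernel s _ _)]
  rw [Measure.volume_eq_prod,
    integral_prod_mul (fun x => heatKernel s X.1 x * heatKernel t x Z.1)
      (fun y => mehlerKernel ω (Real.exp (-ω * s)) X.2 y * mehlerKernel ω (Real.exp (-ω * t)) y Z.2),
    integral_heatKernel_mul hs ht, integral_mehlerKernel_mul hω (Real.exp_pos _)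
      (by rw [Real.exp_lt_one_iff]; nlinarith) (Real.exp_pos _)
      (by rw [Real.exp_lt_one_iff]; nlinarith), ← Real.exp_add]
  ring_nf

/-- The kernel of `E* E` for the operator `E` with kernel `traceKernel`. -/
theorem integral_traceKernel_mul {ω t : ℝ} (hω : 0 < ω) (ht : 0 < t) (z z' : R3) :
    ∫ X, traceKernel ω t X z * traceKernel ω t X z' =
      heatKernel (2 * t) z z' * mehlerKernel ω (Real.exp (-ω * (2 * t))) z z' := by
  -- By symmetry of the kernel this is the semigroup law between two points of the plane x = y.
  have h := integral_evolutionKernel_mul hω ht ht (z, z) (z', z')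
  rw [← two_mul] at h
  rw [evolutionKernel] at h
  rw [← h]
  refine integral_congr_ae (Filter.Eventually.of_forall fun X => ?_)
  simp only [traceKernel, evolutionKernel]
  rw [heatKernel_swap t z, mehlerKernel_swap ω _ z]

end Kernels

end ZeroRange

namespace ZeroRange

open scoped ENNReal InnerProductSpace

/-! ### The Green function as a Laplace transform -/

section Green

theorem image_exp_neg_Ioi {ω : ℝ} (hω : 0 < ω) :
    (fun t => Real.exp (-ω * t)) '' Set.Ioi 0 = Set.Ioo 0 1 := by
  ext ν
  constructor
  · rintro ⟨t, ht, rfl⟩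
    rw [Set.mem_Ioi] at ht
    exact ⟨Real.exp_pos _, by rw [Real.exp_lt_one_iff]; nlinarith⟩
  · rintro ⟨h0, h1⟩
    refine ⟨-Real.log ν / ω, div_pos (by linarith [Real.log_neg h0 h1]) hω, ?_⟩
    simp only
    rw [show -ω * (-Real.log ν / ω) = Real.log ν by field_simp, Real.exp_log h0]

theorem evolutionKernel_eq {ω t : ℝ} (hω : 0 < ω) (ht : 0 < t) (X X' : R3 × R3) :
    evolutionKernel ω t X X' =
      ω ^ 3 / ((2 : ℝ) ^ (3 / 2 : ℝ) * Real.pi ^ 3) *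
        (1 / ((1 - Real.exp (-ω * t) ^ 2) ^ (3 / 2 : ℝ) * (ω * t) ^ (3 / 2 : ℝ))) *
        Real.exp (-(ω / 2 * ((1 - Real.exp (-ω * t)) / (1 + Real.exp (-ω * t))) *
            (‖X.2‖ ^ 2 + ‖X'.2‖ ^ 2)) - ω / (2 * (ω * t)) * ‖X.1 - X'.1‖ ^ 2 -
            ω * Real.exp (-ω * t) / (1 - Real.exp (-ω * t) ^ 2) * ‖X.2 - X'.2‖ ^ 2) := by
  have hν0 : 0 < Real.exp (-ω * t) := Real.exp_pos _
  have hν1 : Real.exp (-ω * t) < 1 := by rw [Real.exp_lt_one_iff]; nlinarith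
  unfold evolutionKernel heatKernel mehlerKernel gaussKernel
  generalize Real.exp (-ω * t) = ν at *
  have h1 : 0 < 1 - ν := by linarith
  have h2 : 0 < 1 - ν ^ 2 := by nlinarith
  have hfac : 1 - ν ^ 2 = (1 - ν) * (1 + ν) := by ring
  have hpi := Real.pi_pos
  have hsq : ∀ x : ℝ, 0 < x → x ^ (3 / 2 : ℝ) * x ^ (3 / 2 : ℝ) = x ^ 3 := fun x hx => by
    rw [← Real.rpow_add hx, ← Real.rpow_natCast x 3]; norm_num
  rw [mul_mul_mul_comm, ← Real.exp_add]
  congr 1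
  · rw [abs_of_pos (by positivity), abs_of_pos (by positivity), Real.div_rpow (by positivity)
      (by positivity), Real.div_rpow (by positivity) (by positivity), Real.one_rpow,
      Real.mul_rpow (by positivity) (by positivity), Real.mul_rpow (by positivity) (by positivity),
      Real.mul_rpow (by positivity) (by positivity), Real.mul_rpow (by positivity) (by positivity),
      ← hsq ω hω, ← hsq _ hpi]
    field_simp
  · congr 1
    rw [norm_sub_sq_real, norm_sub_sq_real]
    rw [hfac]
    field_simp
    ring

/-- Substitute `ν = exp (-ω t)`: then ln(1/ν) = ωt, the power of `ν` times |dν/dt| is ω exp(-λt),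
and the extra ω turns ω² into the ω³ of the evolution kernel. -/
theorem greenKernel_eq {ω : ℝ} (hω : 0 < ω) (lam : ℝ) (X X' : R3 × R3) :
    greenKernel ω lam X X' =
      ∫ t in Set.Ioi (0 : ℝ), Real.exp (-lam * t) * evolutionKernel ω t X X' := by
  unfold greenKernel
  rw [← image_exp_neg_Ioi hω, integral_image_eq_integral_abs_deriv_smul measurableSet_Ioi
    (f' := fun t => Real.exp (-ω * t) * -ω), ← integral_const_mul]
  · refine setIntegral_congr_fun measurableSet_Ioi fun t ht => ?_
    rw [Set.mem_Ioi] at ht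
    have hν0 : 0 < Real.exp (-ω * t) := Real.exp_pos _
    have hlog : Real.log (1 / Real.exp (-ω * t)) = ω * t := by
      rw [one_div, ← Real.exp_neg, Real.log_exp]; ring
    have hpow : Real.exp (-ω * t) ^ (lam / ω - 1) = Real.exp (-lam * t) / Real.exp (-ω * t) := by
      rw [← Real.exp_mul, ← Real.exp_sub]
      congr 1
      field_simp
      ring
    rw [evolutionKernel_eq hω ht, hlog, hpow, mul_neg, abs_neg, abs_of_pos (by positivity),
      smul_eq_mul]
    field_simp
  · intro t _
    have h : HasDerivAt (fun t => -ω * t) (-ω) t := by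
      simpa using (hasDerivAt_id t).const_mul (-ω)
    exact h.exp.hasDerivWithinAt
  · intro s _ t _ hst
    have h := Real.exp_injective hst
    exact mul_left_cancel₀ (by linarith : -ω ≠ 0) h

end Green

/-! ### The oscillator semigroup and its low-energy subspaces -/

section Operators

theorem div_one_add_le_one_sub_exp_neg {u : ℝ} (hu : 0 ≤ u) : u / (1 + u) ≤ 1 - Real.exp (-u) := by
  have h1 : Real.exp (-u) ≤ 1 / (1 + u) := by
    rw [Real.exp_neg, ← one_div]
    exact one_div_le_one_div_of_le (by linarith) (by linarith [Real.add_one_le_exp u])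
  have h2 : u / (1 + u) = 1 - 1 / (1 + u) := by field_simp; ring
  linarith

/-- The semigroup of the harmonic oscillator on `L²(ℝ³)`, with `ν = exp (-Ω t)`. -/
def mehlerOp (Ω ν : ℝ) : L2R3 →L[ℂ] L2R3 := integralOperator volume volume (mehlerKernel Ω ν)

/-- The semigroup `exp (-t H₀)`. -/
def evolutionOp (ω t : ℝ) : L2R6 →L[ℂ] L2R6 :=
  integralOperator volume volume (evolutionKernel ω t)

/-- The composition of `exp (-t H₀)` with the adjoint of the restriction to the plane `x = y`. -/
def traceOp (ω t : ℝ) : L2R3 →L[ℂ] L2R6 := integralOperator volume volume (traceKernel ω t)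

variable {Ω ν ω t : ℝ}

theorem mehlerOp_spec (hΩ : 0 < Ω) (hν : 0 < ν) (hν1 : ν < 1) :
    IsIntegralOperator (mehlerOp Ω ν) (mehlerKernel Ω ν) ∧ ‖mehlerOp Ω ν‖ ≤ 4 := by
  have h := isIntegralOperator_integralOperator (measurable_gaussKernel _ _ _ _)
    (mehlerKernel_nonneg Ω ν) ENNReal.ofReal_ne_top (kernelBound_mehlerKernel hΩ hν hν1)
  rwa [ENNReal.toReal_ofReal (by norm_num)] at h

theorem evolutionOp_spec (hω : 0 < ω) (ht : 0 < t) :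
    IsIntegralOperator (evolutionOp ω t) (evolutionKernel ω t) ∧ ‖evolutionOp ω t‖ ≤ 4 := by
  have h := isIntegralOperator_integralOperator (measurable_evolutionKernel_right ω t)
    (evolutionKernel_nonneg ω t) ENNReal.ofReal_ne_top (kernelBound_evolutionKernel hω ht)
  rwa [ENNReal.toReal_ofReal (by norm_num)] at h

theorem mehlerOp_mehlerOp {ν' : ℝ} (hΩ : 0 < Ω) (hν : 0 < ν) (hν1 : ν < 1) (hν' : 0 < ν')
    (hν1' : ν' < 1) (f : L2R3) : mehlerOp Ω ν (mehlerOp Ω ν' f) = mehlerOp Ω (ν * ν') f :=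
  (mehlerOp_spec hΩ hν' hν1').1.comp_apply (measurable_gaussKernel _ _ _ _)
    (mehlerKernel_nonneg Ω ν') ENNReal.ofReal_ne_top (kernelBound_mehlerKernel hΩ hν' hν1')
    (mehlerOp_spec hΩ hν hν1).1 (measurable_gaussKernel _ _ _ _)
    (mehlerKernel_nonneg Ω ν) ENNReal.ofReal_ne_top (kernelBound_mehlerKernel hΩ hν hν1)
    (mehlerOp_spec hΩ (mul_pos hν hν') (by nlinarith)).1
    (fun x z => integral_mehlerKernel_mul hΩ hν hν1 hν' hν1' x z) f

theorem isSelfAdjoint_mehlerOp (hΩ : 0 < Ω) (hν : 0 < ν) (hν1 : ν < 1) :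
    IsSelfAdjoint (mehlerOp Ω ν) :=
  (mehlerOp_spec hΩ hν hν1).1.isSelfAdjoint (measurable_gaussKernel _ _ _ _)
    (mehlerKernel_nonneg Ω ν) ENNReal.ofReal_ne_top (kernelBound_mehlerKernel hΩ hν hν1)
    fun x y => mehlerKernel_swap Ω ν y x

theorem mehlerOp_mehlerOp_pow {ν' : ℝ} (hΩ : 0 < Ω) (hν : 0 < ν) (hν1 : ν < 1) (hν' : 0 < ν')
    (hν1' : ν' < 1) (j : ℕ) (f : L2R3) :
    mehlerOp Ω ν' ((mehlerOp Ω ν ^ j) f) = mehlerOp Ω (ν' * ν ^ j) f := by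
  induction j generalizing f with
  | zero => simp
  | succ j ih =>
    have h1 : (mehlerOp Ω ν ^ (j + 1)) f = (mehlerOp Ω ν ^ j) (mehlerOp Ω ν f) := by
      rw [pow_succ]; rfl
    have h2 : ν' * ν ^ j < 1 :=
      lt_of_le_of_lt (mul_le_of_le_one_right hν'.le (pow_le_one₀ hν.le hν1.le)) hν1'
    rw [h1, ih, mehlerOp_mehlerOp hΩ (by positivity) h2 hν hν1, pow_succ, mul_assoc]

/-- The Hilbert–Schmidt norm of the Mehler semigroup. -/
theorem sum_norm_mehlerOp_sq_le (hΩ : 0 < Ω) (hν : 0 < ν) (hν1 : ν < 1) {ι : Type*} [Fintype ι]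
    {v : ι → L2R3} (hv : Orthonormal ℂ v) :
    ∑ i, ‖mehlerOp Ω ν (v i)‖ ^ 2 ≤ (1 / (1 - ν ^ 2) ^ 2) ^ (3 / 2 : ℝ) := by
  have h1 : 0 < 1 - ν ^ 2 := by nlinarith
  have hpi := Real.pi_pos
  have hα : 0 < Ω * (1 + ν ^ 2) / (2 * (1 - ν ^ 2)) + Ω * (1 + ν ^ 2) / (2 * (1 - ν ^ 2)) := by
    positivity
  refine (mehlerOp_spec hΩ hν hν1).1.sum_norm_sq_le (fun y => ?_) (mehlerKernel_nonneg Ω ν)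
    (by positivity) ?_ hv
  · refine (memLp_two_iff_integrable_sq_norm ?_).2 ?_
    · exact (Complex.continuous_ofReal.comp ((continuous_gaussKernel _ _ _ _).comp
        (Continuous.prodMk_right y))).aestronglyMeasurable
    · refine Integrable.congr (f := fun x => mehlerKernel Ω ν y x * mehlerKernel Ω ν y x) ?_
        (Filter.Eventually.of_forall fun x => ?_)
      · simp only [mehlerKernel, gaussKernel_mul]
        exact integrable_gaussKernel hα y
      · simp only
        rw [Complex.norm_real, Real.norm_of_nonneg (mehlerKernel_nonneg Ω ν _ _), sq]
  -- The inner integral is a plain Gaussian in `y`. Writing it as a Gaussian kernel with first point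
  -- 0 lets the same formula perform the outer integration.
  · have h2 : ∀ y, ∫⁻ x, ENNReal.ofReal (mehlerKernel Ω ν y x) ^ 2 = ENNReal.ofReal
        (gaussKernel ((Ω / (Real.pi * (1 - ν ^ 2))) ^ 2 *
          (Real.pi / (Ω * (1 + ν ^ 2) / (1 - ν ^ 2)))) 0
          (Ω * (1 - ν ^ 2) / (1 + ν ^ 2)) 0 0 y) := by
      intro y
      simp only [sq (ENNReal.ofReal _), ← ENNReal.ofReal_mul (mehlerKernel_nonneg Ω ν _ _)]
      simp only [mehlerKernel, gaussKernel_mul]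
      rw [lintegral_gaussKernel hα]
      congr 1
      unfold gaussKernel
      congr 2
      · congr 1
        field_simp
        norm_num
      · simp only [norm_zero]
        field_simp
        ring
    simp only [h2]
    have hd : 0 < Ω * (1 - ν ^ 2) / (1 + ν ^ 2) := by positivity
    refine (lintegral_gaussKernel_le hd (by simp) 0).trans_eq ?_
    congr 2
    rw [abs_of_pos (by positivity)]
    field_simp

theorem exists_submodule_mehlerOp (hΩ : 0 < Ω) {N : ℕ} (hN : 0 < N) :
    ∃ V : Submodule ℂ L2R3, FiniteDimensional ℂ V ∧ Module.finrank ℂ V ≤ 72 * N ^ 3 ∧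
      ∀ f ∈ Vᗮ, ∀ l : ℝ, 0 < l →
        ‖mehlerOp Ω (Real.exp (-l)) f‖ ≤ 12 * Real.exp (-(N * l)) * ‖f‖ := by
  have hN0 : (0 : ℝ) < N := by exact_mod_cast hN
  have hN1 : (1 : ℝ) ≤ N := by exact_mod_cast hN
  -- The semigroup at time 1/N, cut at the eigenvalue 1/e. Here 1 - ν² ≥ 1 - ν ≥ 1/(N+1) ≥ 1/(2N),
  -- so the squared Hilbert–Schmidt norm (1-ν²)^{-3} is at most 8N³, and e² ≤ 9 gives 72.
  set ν := Real.exp (-(1 / N : ℝ))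
  have hν : 0 < ν := Real.exp_pos _
  have hν1 : ν < 1 := by
    rw [Real.exp_lt_one_iff]; simpa using hN0
  have hlow : 1 / (2 * N : ℝ) ≤ 1 - ν ^ 2 := by
    have h1 := div_one_add_le_one_sub_exp_neg (u := (1 / N : ℝ)) (by positivity)
    have h2 : 1 / (2 * N : ℝ) ≤ (1 / N : ℝ) / (1 + 1 / N) := by
      rw [div_le_div_iff₀ (by positivity) (by positivity)]
      field_simp
      linarith
    have h3 : ν ^ 2 ≤ ν := by nlinarith
    linarith
  obtain ⟨V, hfin, hdim, hV⟩ := exists_submodule_pow_le (isSelfAdjoint_mehlerOp hΩ hν hν1)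
    (fun ι _ v hv => sum_norm_mehlerOp_sq_le hΩ hν hν1 hv) (Real.exp_pos (-1))
  refine ⟨V, hfin, ?_, fun f hf l hl => ?_⟩
  · have h1 : (1 / (1 - ν ^ 2) ^ 2) ^ (3 / 2 : ℝ) ≤ 8 * (N : ℝ) ^ 3 := by
      have h4 : 0 < 1 - ν ^ 2 := lt_of_lt_of_le (by positivity) hlow
      calc (1 / (1 - ν ^ 2) ^ 2) ^ (3 / 2 : ℝ) ≤ ((2 * N : ℝ) ^ 2) ^ (3 / 2 : ℝ) := by
            gcongr
            rw [div_le_iff₀ (by positivity), ← mul_pow]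
            refine one_le_pow₀ ?_
            rwa [div_le_iff₀ (by positivity), mul_comm] at hlow
        _ = (2 * N : ℝ) ^ 3 := by
            rw [← Real.rpow_natCast, ← Real.rpow_natCast, ← Real.rpow_mul (by positivity)]
            norm_num
        _ = _ := by ring
    have h2 := hdim.trans h1
    have h3 : Real.exp (-1) ^ 2 * 9 ≥ 1 := by
      have h5 : Real.exp 1 * Real.exp (-1) = 1 := by rw [← Real.exp_add]; simp
      nlinarith [Real.exp_one_lt_d9, Real.exp_pos (-1), Real.exp_pos 1]
    have h4 : (Module.finrank ℂ V : ℝ) ≤ 72 * (N : ℝ) ^ 3 := by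
      nlinarith [(Nat.cast_nonneg (Module.finrank ℂ V) : (0 : ℝ) ≤ _)]
    exact_mod_cast h4
  -- The largest integer strictly below `N * l`: the leftover time l - j/N must be positive for the
  -- Mehler kernel to make sense, and it is at most 1/N. The constant 12 is the norm bound 4 times 3
  -- ≥ e, the loss from rounding.
  · set j : ℕ := ⌈(N : ℝ) * l⌉₊ - 1
    have hceil : 0 < ⌈(N : ℝ) * l⌉₊ := Nat.ceil_pos.2 (by positivity)
    have hj : (j : ℝ) = ⌈(N : ℝ) * l⌉₊ - 1 := by
      simp only [j]; rw [Nat.cast_sub hceil]; simp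
    have hj1 : (j : ℝ) < N * l := by
      rw [hj]; linarith [Nat.ceil_lt_add_one (show (0 : ℝ) ≤ N * l by positivity)]
    have hj2 : N * l - 1 ≤ (j : ℝ) := by
      rw [hj]; linarith [Nat.le_ceil ((N : ℝ) * l)]
    have hr : Real.exp (-(l - j / N)) < 1 := by
      rw [Real.exp_lt_one_iff, neg_lt_zero, sub_pos, div_lt_iff₀ hN0]; linarith
    have hsplit : Real.exp (-(l - j / N)) * ν ^ j = Real.exp (-l) := by
      rw [← Real.exp_nat_mul, ← Real.exp_add]
      congr 1
      field_simp
      ring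
    rw [← hsplit, ← mehlerOp_mehlerOp_pow hΩ hν hν1 (Real.exp_pos _) hr]
    refine (ContinuousLinearMap.le_of_opNorm_le _
      (mehlerOp_spec hΩ (Real.exp_pos _) hr).2 _).trans ?_
    have h1 : Real.exp (-1) ^ j ≤ 3 * Real.exp (-(N * l)) := by
      rw [← Real.exp_nat_mul]
      calc Real.exp (j * -1) ≤ Real.exp (1 + -(N * l)) := by
            rw [Real.exp_le_exp]; linarith
        _ = Real.exp 1 * Real.exp (-(N * l)) := Real.exp_add _ _
        _ ≤ _ := by gcongr; linarith [Real.exp_one_lt_d9]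
    calc 4 * ‖(mehlerOp Ω ν ^ j) f‖ ≤ 4 * (Real.exp (-1) ^ j * ‖f‖) := by gcongr; exact hV j f hf
      _ ≤ 4 * (3 * Real.exp (-(N * l)) * ‖f‖) := by gcongr
      _ = _ := by ring

end Operators

end ZeroRange

namespace ZeroRange

open scoped ENNReal InnerProductSpace

/-! ### Decay of the trace operators and conclusion -/

section Trace

variable {ω t : ℝ}

/-- The exponents are split to exhibit the factors exp(-a|z|²), exp(-b|z-z'|²), exp(-a|z'|²). The
heat kernel contributes to `b` only. -/
theorem integral_traceKernel_mul_eq_gaussKernel (hω : 0 < ω) (ht : 0 < t) {n : ℝ}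
    (hn : n = Real.exp (-ω * (2 * t))) (z z' : R3) :
    ∫ X, traceKernel ω t X z * traceKernel ω t X z' =
      gaussKernel (1 / (4 * Real.pi * t) * (ω / (Real.pi * (1 - n ^ 2))))
        (ω * (1 - n) / (2 * (1 + n)) + (1 / (4 * t) + ω * n / (1 - n ^ 2)))
        (ω * (1 - n) / (2 * (1 + n)) + (1 / (4 * t) + ω * n / (1 - n ^ 2)))
        (1 / (4 * t) + ω * n / (1 - n ^ 2)) z z' := by
  have hn0 : 0 < n := hn ▸ Real.exp_pos _
  have hn1 : n < 1 := by rw [hn, Real.exp_lt_one_iff]; nlinarith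
  have h1 : 0 < 1 - n := by linarith
  have hfac : 1 - n ^ 2 = (1 - n) * (1 + n) := by ring
  rw [integral_traceKernel_mul hω ht, ← hn, heatKernel, mehlerKernel, gaussKernel_mul]
  congr 1
  · congr 2; ring
  · rw [hfac]; field_simp; ring
  · rw [hfac]; field_simp; ring
  · congr 2; ring

theorem trace_const_le (hω : 0 < ω) (ht : 0 < t) :
    ω / (Real.pi * (1 - Real.exp (-ω * (2 * t)) ^ 2)) ≤ (1 + ω) * (1 / t + 1) := by
  have hexp : Real.exp (-ω * (2 * t)) ^ 2 = Real.exp (-(4 * ω * t)) := by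
    rw [← Real.exp_nat_mul]; congr 1; push_cast; ring
  have h1 := div_one_add_le_one_sub_exp_neg (u := 4 * ω * t) (by positivity)
  rw [hexp]
  calc ω / (Real.pi * (1 - Real.exp (-(4 * ω * t))))
      ≤ ω / (1 * (4 * ω * t / (1 + 4 * ω * t))) := by
        gcongr
        linarith [Real.two_le_pi]
    _ = 1 / (4 * t) + ω := by field_simp
    _ ≤ 1 / t + ω := by
        gcongr
        linarith
    _ ≤ _ := by
        have : 0 < ω / t := by positivity
        have h2 : (1 + ω) * (1 / t + 1) = 1 / t + ω + (ω / t + 1) := by field_simp; ring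
        linarith

theorem kernelBound_traceKernel (hω : 0 < ω) (ht : 0 < t) :
    KernelBound volume volume (fun X z => ENNReal.ofReal (traceKernel ω t X z))
      (ENNReal.ofReal (2 * ((1 + ω) * (1 / t + 1)) ^ (3 / 4 : ℝ))) := by
  have hB : 0 < (1 + ω) * (1 / t + 1) := by positivity
  set n := Real.exp (-ω * (2 * t)) with hn
  have hn0 : 0 < n := Real.exp_pos _
  have hn1 : n < 1 := by rw [hn, Real.exp_lt_one_iff]; nlinarith
  have h1 : 0 < 1 - n := by linarith
  have h2 : 0 < 1 - n ^ 2 := by nlinarith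
  have hpi := Real.pi_pos
  set b := 1 / (4 * t) + ω * n / (1 - n ^ 2) with hbdef
  have hb : 1 / (4 * t) ≤ b := le_add_of_nonneg_right (by positivity)
  have hb0 : 0 < b := lt_of_lt_of_le (by positivity) hb
  have ha : 0 ≤ ω * (1 - n) / (2 * (1 + n)) := by positivity
  have hκ : 0 < 1 / (4 * Real.pi * t) * (ω / (Real.pi * (1 - n ^ 2))) := by positivity
  refine kernelBound_of_schur_sq (measurable_traceKernel_right ω t).ennreal_ofReal
    (D := ENNReal.ofReal (((1 + ω) * (1 / t + 1)) ^ (3 / 2 : ℝ))) (fun z => ?_) ?_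
  · have hL : ∀ z', ∫⁻ X, ENNReal.ofReal (traceKernel ω t X z) *
        ENNReal.ofReal (traceKernel ω t X z') = ENNReal.ofReal
          (gaussKernel (1 / (4 * Real.pi * t) * (ω / (Real.pi * (1 - n ^ 2))))
            (ω * (1 - n) / (2 * (1 + n)) + b) (ω * (1 - n) / (2 * (1 + n)) + b) b z z') := by
      intro z'
      have hI := integral_traceKernel_mul_eq_gaussKernel hω ht hn z z'
      -- Otherwise the integral would be 0 by convention, but it equals a positive Gaussian.
      have hint : Integrable fun X => traceKernel ω t X z * traceKernel ω t X z' := by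
        by_contra h
        rw [integral_undef h] at hI
        refine absurd hI (ne_of_lt ?_)
        unfold gaussKernel
        positivity
      rw [← hI, ofReal_integral_eq_lintegral_ofReal hint (Filter.Eventually.of_forall fun X =>
        mul_nonneg (traceKernel_nonneg _ _ _ _) (traceKernel_nonneg _ _ _ _))]
      simp only [ENNReal.ofReal_mul (traceKernel_nonneg _ _ _ _)]
    simp only [hL]
    refine (lintegral_gaussKernel_le (by positivity) (by nlinarith) z).trans
      (ENNReal.ofReal_le_ofReal ?_)
    rw [abs_of_pos (by positivity)]
    refine Real.rpow_le_rpow (by positivity) ?_ (by norm_num)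
    -- Bounding `b` below by its heat part 1/(4t) cancels the heat prefactor. The Mehler prefactor
    -- remains, of order 1/t for small `t`. The power 3/2 for E* E becomes t^{-3/4} for E.
    calc 1 / (4 * Real.pi * t) * (ω / (Real.pi * (1 - n ^ 2))) *
          (Real.pi / (ω * (1 - n) / (2 * (1 + n)) + b))
        ≤ 1 / (4 * Real.pi * t) * (ω / (Real.pi * (1 - n ^ 2))) * (Real.pi / (1 / (4 * t))) := by
          gcongr
          linarith
      _ = ω / (Real.pi * (1 - n ^ 2)) := by field_simp
      _ ≤ _ := trace_const_le hω ht
  · rw [← ENNReal.ofReal_pow (by positivity), mul_pow, ← Real.rpow_natCast (_ ^ (3 / 4 : ℝ)),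
      ← Real.rpow_mul hB.le, show (3 / 4 : ℝ) * (2 : ℕ) = 3 / 2 by norm_num,
      show (2 : ℝ≥0∞) = ENNReal.ofReal 2 by simp, ← ENNReal.ofReal_mul (by norm_num)]
    refine ENNReal.ofReal_le_ofReal ?_
    gcongr
    norm_num

theorem isIntegralOperator_traceOp (hω : 0 < ω) (ht : 0 < t) :
    IsIntegralOperator (traceOp ω t) (traceKernel ω t) :=
  (isIntegralOperator_integralOperator (measurable_traceKernel_right ω t)
    (traceKernel_nonneg ω t) ENNReal.ofReal_ne_top (kernelBound_traceKernel hω ht)).1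

theorem evolutionOp_traceOp {s : ℝ} (hω : 0 < ω) (hs : 0 < s) (ht : 0 < t) (f : L2R3) :
    evolutionOp ω s (traceOp ω t f) = traceOp ω (s + t) f :=
  (isIntegralOperator_traceOp hω ht).comp_apply (measurable_traceKernel_right ω t)
    (traceKernel_nonneg ω t) ENNReal.ofReal_ne_top (kernelBound_traceKernel hω ht)
    (evolutionOp_spec hω hs).1 (measurable_evolutionKernel_right ω s)
    (evolutionKernel_nonneg ω s) ENNReal.ofReal_ne_top (kernelBound_evolutionKernel hω hs)
    (isIntegralOperator_traceOp hω (by positivity))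
    (fun X z => integral_evolutionKernel_mul hω hs ht X (z, z)) f

/-- The trace operator is controlled by the semigroup of a harmonic oscillator of frequency
`2 ω`. -/
theorem norm_traceOp_le (hω : 0 < ω) (ht : 0 < t) (f : L2R3) :
    ‖traceOp ω t f‖ ≤ ((1 + ω) * (1 / t + 1)) ^ (3 / 4 : ℝ) *
      ‖mehlerOp (2 * ω) (Real.sqrt ((1 + 3 * Real.exp (-ω * (2 * t))) /
        (3 + Real.exp (-ω * (2 * t))))) f‖ := by
  have hB : 0 < (1 + ω) * (1 / t + 1) := by positivity
  have htr := trace_const_le hω ht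
  have hlin : 1 - Real.exp (-ω * (2 * t)) ≤ 2 * ω * t := by
    linarith [Real.add_one_le_exp (-ω * (2 * t))]
  have hI := integral_traceKernel_mul_eq_gaussKernel hω ht rfl
  have hn0 : 0 < Real.exp (-ω * (2 * t)) := Real.exp_pos _
  have hn1 : Real.exp (-ω * (2 * t)) < 1 := by rw [Real.exp_lt_one_iff]; nlinarith
  generalize Real.exp (-ω * (2 * t)) = n at *
  have h1 : 0 < 1 - n := by linarith
  have h2 : 0 < 1 - n ^ 2 := by nlinarith
  have hfacn : 1 - n ^ 2 = (1 - n) * (1 + n) := by ring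
  have hpi := Real.pi_pos
  -- `m` solves (1-m)/(1+m) = (1-n)/(2(1+n)), which equates the two values of `a`. The semigroup is
  -- taken at `√m` because the comparison involves its square.
  obtain ⟨m, hm⟩ : ∃ m, m = (1 + 3 * n) / (3 + n) := ⟨_, rfl⟩
  rw [← hm]
  have hm0 : 0 < m := by rw [hm]; positivity
  have hm1 : m < 1 := by rw [hm, div_lt_one (by positivity)]; linarith
  have hs0 : 0 < Real.sqrt m := Real.sqrt_pos.2 hm0
  have hs1 : Real.sqrt m < 1 := by rw [Real.sqrt_lt' one_pos]; simpa using hm1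
  have h3 : 0 < 1 - m := by linarith
  have h4 : 0 < 1 - m ^ 2 := by nlinarith
  have hfac : 1 - m ^ 2 = (1 - m) * (1 + m) := by ring
  set a := ω * (1 - n) / (2 * (1 + n)) with ha
  set b := 1 / (4 * t) + ω * n / (1 - n ^ 2) with hb
  set b' := 2 * ω * m / (1 - m ^ 2) with hb'
  have ha0 : 0 ≤ a := by positivity
  have hb0 : 0 < b := by positivity
  have ham : a = ω * (1 - m) / (1 + m) := by
    have e1 : 1 - m = 2 * (1 - n) / (3 + n) := by rw [hm]; field_simp; ring
    have e2 : 1 + m = 4 * (1 + n) / (3 + n) := by rw [hm]; field_simp; ring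
    rw [ha, e1, e2]
    field_simp
    ring
  -- The reason for doubling the frequency: at frequency ω equality of `a` would force m = n, and b'
  -- would lack the heat term 1/(4t). With 2ω the surplus 3ω(1+n)/(4(1-n)) beats it, since 1 - n ≤
  -- 2ωt.
  have hbb' : b < b' := by
    have e1 : b' = ω * n / (1 - n ^ 2) + 3 * ω * (1 + n) / (4 * (1 - n)) := by
      have e2 : 1 - m ^ 2 = 8 * ((1 - n) * (1 + n)) / (3 + n) ^ 2 := by rw [hm]; field_simp; ring
      rw [hb', e2, hm, hfacn]
      field_simp
      ring
    have e3 : 1 / (4 * t) < 3 * ω * (1 + n) / (4 * (1 - n)) := by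
      rw [div_lt_div_iff₀ (by positivity) (by positivity)]
      have : 0 < ω * t := by positivity
      nlinarith [mul_pos this hn0]
    linarith
  have hL' : ∀ x x', ∫ y, mehlerKernel (2 * ω) (Real.sqrt m) y x *
      mehlerKernel (2 * ω) (Real.sqrt m) y x' =
        gaussKernel (2 * ω / (Real.pi * (1 - m ^ 2))) (a + b') (a + b') b' x x' := by
    intro x x'
    simp only [mehlerKernel_swap _ _ x]
    rw [integral_mehlerKernel_mul (by positivity) hs0 hs1 hs0 hs1, Real.mul_self_sqrt hm0.le,
      mehlerKernel]
    have e1 : 2 * ω * (1 + m ^ 2) / (2 * (1 - m ^ 2)) = a + b' := by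
      rw [ham, hb', hfac]
      field_simp
      ring
    rw [e1]
  have key := norm_sq_le_of_gaussKernel ha0 hb0 hbb' (by positivity) (by positivity)
    (isIntegralOperator_traceOp hω ht) (measurable_traceKernel_right ω t)
    (traceKernel_nonneg ω t) ENNReal.ofReal_ne_top (kernelBound_traceKernel hω ht) hI
    (mehlerOp_spec (by positivity) hs0 hs1).1 (measurable_gaussKernel _ _ _ _)
    (mehlerKernel_nonneg _ _) ENNReal.ofReal_ne_top
    (kernelBound_mehlerKernel (by positivity) hs0 hs1) hL' f
  have hconst : 1 / (4 * Real.pi * t) * (ω / (Real.pi * (1 - n ^ 2))) * b' /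
      (2 * ω / (Real.pi * (1 - m ^ 2)) * b) ≤ (1 + ω) * (1 / t + 1) := by
    calc _ = 1 / (4 * t) / b * m * (ω / (Real.pi * (1 - n ^ 2))) := by
          rw [hb']; field_simp
      _ ≤ 1 * 1 * (ω / (Real.pi * (1 - n ^ 2))) := by
          gcongr
          · rw [div_le_one hb0, hb]
            exact le_add_of_nonneg_right (by positivity)
      _ ≤ _ := by linarith
  refine le_of_sq_le_sq (key.trans ?_) (by positivity)
  rw [mul_pow, ← Real.rpow_natCast (_ ^ (3 / 4 : ℝ)), ← Real.rpow_mul hB.le,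
    show (3 / 4 : ℝ) * (2 : ℕ) = 3 / 2 by norm_num]
  gcongr

theorem rpow_one_div_add_one_le (hω : 0 < ω) (ht : 0 < t) :
    ((1 + ω) * (1 / t + 1)) ^ (3 / 4 : ℝ) ≤
      (1 + ω) ^ (3 / 4 : ℝ) * (t ^ (-(3 / 4) : ℝ) + 1) := by
  rw [Real.mul_rpow (by positivity) (by positivity)]
  gcongr
  refine (Real.rpow_add_le_add_rpow (by positivity) zero_le_one (by norm_num) (by norm_num)).trans_eq
    ?_
  rw [one_div, Real.inv_rpow ht.le, Real.rpow_neg ht.le, Real.one_rpow]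

/-- Off a subspace of dimension `O(N³)`, the trace operators decay like `t ^ (-3/4) exp (-c N t)`. -/
theorem exists_submodule_traceOp (hω : 0 < ω) {N : ℕ} (hN : 0 < N) :
    ∃ V : Submodule ℂ L2R3, FiniteDimensional ℂ V ∧ Module.finrank ℂ V ≤ 72 * N ^ 3 ∧
      ∀ f ∈ Vᗮ, ∀ t, 0 < t → ‖traceOp ω t f‖ ≤ 96 * (1 + ω) ^ (3 / 4 : ℝ) *
        (t ^ (-(3 / 4) : ℝ) * Real.exp (-(ω / (2 * (1 + 2 * ω)) * N) * t) +
          Real.exp (-(ω / (2 * (1 + 2 * ω)) * N))) * ‖f‖ := by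
  obtain ⟨V, hfin, hdim, hV⟩ := exists_submodule_mehlerOp (Ω := 2 * ω) (by positivity) hN
  refine ⟨V, hfin, hdim, fun f hf => ?_⟩
  have hN0 : (0 : ℝ) < N := by exact_mod_cast hN
  -- Chosen so that 1 - n ≥ 2ωt/(1+2ω) = 4ct for t ≤ 1. Then m ≤ 1 - (1-n)/2 ≤ exp(-2ct), so the
  -- comparison oscillator has evolved for a time at least ct.
  set c := ω / (2 * (1 + 2 * ω)) with hc
  have hc0 : 0 < c := by positivity
  have hsmall : ∀ t, 0 < t → t ≤ 1 → ‖traceOp ω t f‖ ≤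
      24 * (1 + ω) ^ (3 / 4 : ℝ) * (t ^ (-(3 / 4) : ℝ) * Real.exp (-(c * N) * t)) * ‖f‖ := by
    intro t ht ht1
    have h0 := norm_traceOp_le hω ht f
    have hlow : 4 * c * t ≤ 1 - Real.exp (-ω * (2 * t)) := by
      have h1 := div_one_add_le_one_sub_exp_neg (u := 2 * ω * t) (by positivity)
      rw [show -(2 * ω * t) = -ω * (2 * t) by ring] at h1
      refine le_trans ?_ h1
      calc 4 * c * t = 2 * ω * t / (1 + 2 * ω) := by rw [hc]; field_simp; ring
        _ ≤ _ := div_le_div_of_nonneg_left (by positivity) (by positivity) (by nlinarith)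
    have hn0 : 0 < Real.exp (-ω * (2 * t)) := Real.exp_pos _
    generalize Real.exp (-ω * (2 * t)) = n at *
    have hn1 : n < 1 := by have : 0 < 4 * c * t := by positivity
                           linarith
    have hm0 : 0 < (1 + 3 * n) / (3 + n) := by positivity
    have hm : (1 + 3 * n) / (3 + n) ≤ Real.exp (-(2 * (c * t))) := by
      refine le_trans ?_ (Real.add_one_le_exp _)
      rw [div_le_iff₀ (by positivity)]
      nlinarith
    have hs : Real.sqrt ((1 + 3 * n) / (3 + n)) = Real.exp (-(-Real.log
        (Real.sqrt ((1 + 3 * n) / (3 + n))))) := by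
      rw [neg_neg, Real.exp_log (Real.sqrt_pos.2 hm0)]
    have hl : c * t ≤ -Real.log (Real.sqrt ((1 + 3 * n) / (3 + n))) := by
      rw [Real.log_sqrt hm0.le, le_neg, div_le_iff₀ two_pos]
      have := (Real.log_le_iff_le_exp hm0).2 hm
      linarith
    have hct : 0 < c * t := by positivity
    have h1 := hV f hf _ (hct.trans_le hl)
    rw [← hs] at h1
    have ht34 : 1 ≤ t ^ (-(3 / 4) : ℝ) := Real.one_le_rpow_of_pos_of_le_one_of_nonpos ht ht1
      (by norm_num)
    have h2 : Real.exp (-(N * -Real.log (Real.sqrt ((1 + 3 * n) / (3 + n))))) ≤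
        Real.exp (-(c * N) * t) := by
      rw [Real.exp_le_exp]
      nlinarith
    calc ‖traceOp ω t f‖ ≤ ((1 + ω) * (1 / t + 1)) ^ (3 / 4 : ℝ) *
          ‖mehlerOp (2 * ω) (Real.sqrt ((1 + 3 * n) / (3 + n))) f‖ := h0
      _ ≤ ((1 + ω) ^ (3 / 4 : ℝ) * (t ^ (-(3 / 4) : ℝ) + t ^ (-(3 / 4) : ℝ))) *
          (12 * Real.exp (-(c * N) * t) * ‖f‖) := by
          gcongr
          · exact (rpow_one_div_add_one_le hω ht).trans (by gcongr)
          · exact h1.trans (by gcongr)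
      _ = _ := by ring
  intro t ht
  rcases le_or_gt t 1 with ht1 | ht1
  · refine (hsmall t ht ht1).trans ?_
    gcongr
    · norm_num
    · exact le_add_of_nonneg_right (Real.exp_pos _).le
  -- For large `t` the comparison time stays bounded, since `m` tends to 1/3. The decay already
  -- reached at time 1 is kept instead; this is the origin of the term exp(-cN) and of 96 = 4 · 24.
  · have h1 : traceOp ω t f = evolutionOp ω (t - 1) (traceOp ω 1 f) := by
      rw [evolutionOp_traceOp hω (by linarith) one_pos, sub_add_cancel]
    rw [h1]
    refine (ContinuousLinearMap.le_of_opNorm_le _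
      (evolutionOp_spec hω (by linarith : 0 < t - 1)).2 _).trans ?_
    have h2 := hsmall 1 one_pos le_rfl
    rw [Real.one_rpow, one_mul, mul_one] at h2
    calc 4 * ‖traceOp ω 1 f‖ ≤
          4 * (24 * (1 + ω) ^ (3 / 4 : ℝ) * Real.exp (-(c * N)) * ‖f‖) := by gcongr
      _ = 96 * (1 + ω) ^ (3 / 4 : ℝ) * Real.exp (-(c * N)) * ‖f‖ := by ring
      _ ≤ _ := by
          gcongr
          exact le_add_of_nonneg_left (by positivity)

theorem exists_greenOp_potentialOp_isSchatten {ω lam : ℝ} (hω : 0 < ω) (hlam0 : 0 < lam) (k : ℕ) :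
    ∃ (G : L2R6 →L[ℂ] L2R6) (P : L2R3 →L[ℂ] L2R6),
      IsIntegralOperator G (greenKernel ω lam) ∧ IsIntegralOperator P (potentialKernel ω lam) ∧
      ∀ p : ℝ, 3 / ((k : ℝ) + 1 / 2) < p → IsSchatten p (P.adjoint ∘L (G ^ k) ∘L P) := by
  obtain ⟨G, hG, hGi⟩ := exists_laplace_isIntegralOperator (measurable_evolutionKernel ω)
    (evolutionKernel_nonneg ω) (fun t ht => (evolutionOp_spec hω ht).1) (c := fun _ => 4)
    measurable_const (fun _ => by norm_num) (fun t ht => kernelBound_evolutionKernel hω ht)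
    (lam := lam) ((integrableOn_exp_neg hlam0).mul_const 4)
  obtain ⟨P, hP, hPi⟩ := exists_laplace_isIntegralOperator (measurable_traceKernel ω)
    (traceKernel_nonneg ω) (fun t ht => isIntegralOperator_traceOp hω ht)
    -- The absolute value keeps the bound positive for all real `t`. The singularity t^{-3/4} is
    -- integrable at 0, so `P` is bounded.
    (c := fun t => 2 * ((1 + ω) ^ (3 / 4 : ℝ) * (|t| ^ (-(3 / 4) : ℝ) + 1)))
    (by fun_prop) (fun _ => by positivity)
    (fun t ht => (kernelBound_traceKernel hω ht).mono_right (ENNReal.ofReal_le_ofReal (by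
      rw [abs_of_pos ht]
      gcongr
      exact rpow_one_div_add_one_le hω ht)))
    (lam := lam) (by
      refine IntegrableOn.congr_fun ((((integrableOn_rpow_mul_exp hlam0).add
        (integrableOn_exp_neg hlam0)).const_mul (2 * (1 + ω) ^ (3 / 4 : ℝ)))) (fun t ht => ?_)
        measurableSet_Ioi
      rw [Set.mem_Ioi] at ht
      simp only [Pi.add_apply, abs_of_pos ht]
      ring)
  refine ⟨G, P, ?_, ?_, fun p hp => ?_⟩
  · have e : greenKernel ω lam = fun X X' => ∫ t in Set.Ioi (0 : ℝ),
        Real.exp (-lam * t) * evolutionKernel ω t X X' :=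
      funext fun X => funext fun X' => greenKernel_eq hω lam X X'
    rw [e]
    exact hG
  · have e : potentialKernel ω lam = fun X z => ∫ t in Set.Ioi (0 : ℝ),
        Real.exp (-lam * t) * traceKernel ω t X z :=
      funext fun X => funext fun z => greenKernel_eq hω lam X (z, z)
    rw [e]
    exact hP
  · exact isSchatten_adjoint_comp_pow_comp hlam0 hGi hPi
      (fun s t hs ht f => evolutionOp_traceOp hω hs ht f) (by positivity) (by positivity) 72
      (fun N hN => exists_submodule_traceOp hω hN) k hp

end Trace

end ZeroRange

end

theorem mainTheorem12 (ω : ℝ) (hω : 0 < ω) (k : ℕ) (lam : ℝ) (hlam : (k : ℝ) < lam) :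
    ∃ (G : ZeroRange.L2R6 →L[ℂ] ZeroRange.L2R6) (P : ZeroRange.L2R3 →L[ℂ] ZeroRange.L2R6),
      ZeroRange.IsIntegralOperator G (ZeroRange.greenKernel ω lam) ∧
      ZeroRange.IsIntegralOperator P (ZeroRange.potentialKernel ω lam) ∧
      ∀ p : ℝ, 3 / ((k : ℝ) + 1 / 2) < p →
        ZeroRange.IsSchatten p (P.adjoint ∘L (G ^ k) ∘L P) :=
  ZeroRange.exists_greenOp_potentialOp_isSchatten hω (lt_of_le_of_lt k.cast_nonneg hlam) k
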